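/- Let $n\ge 0$, $[n]=\{1,\dots,n\}$, and let $I\subseteq[n]$ with $|I|=r$. Let $K_{B_n}$ be the Coxeter complex of type $B_n$: its vertices are the nonempty sets $L\subseteq\{\pm1,\dots,\pm n\}$ that contain no pair $\{i,-i\}$, and its simplices are the nonempty finite sets of vertices that are totally ordered by inclusion. Let $(K_{B_n})_I$ be its full subcomplex on the vertices $L$ for which $\#\{i\in I : i\in L \text{ or } -i\in L\}$ is odd. Reduced homology $\widetilde H_*$ is taken with rational coefficients, each simplex $L_1\subsetneq\cdots\subsetneq L_{m}$ being oriented by inclusion; in particular $\widetilde H_{-1}(\emptyset)=\mathbb Q$. A signed permutation on $I$ is a map $x\colon I\to\mathbb Z$ such that $|x(i)|\in I$ for all $i$ and $|x(i)|\ne|x(j)|$ for $i\neq j$. It is written as a word $x=x_r\cdots x_2x_1$, where $x_r,x_{r-1},\dots,x_1$ are the values of $x$ at the elements of $I$ taken in increasing order. It is a $B$-snake on $I$ if $0<x_r>x_{r-1}<x_{r-2}>\cdots x_1$ (for $r=0$ the empty word is a $B$-snake). Let $x^*$ be the signed permutation whose word is obtained from that of $x$ by exchanging $x_{2i}$ and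 $x_{2i-1}$ for every $1\le i\le\lfloor r/2\rfloor$ and, if $r$ is odd, replacing $x_r$ by $-x_r$. For $1\le i\le k:=\lfloor\frac{r+1}{2}\rfloor$ put $$\mathcal F_i(x)=\begin{cases}\{x_1,\dots,x_{2i-1}\}, & r \text{ odd},\\ \{-x_1,\dots,-x_{2i-1}\}, & r\text{ even},\end{cases}$$ and let $$\square_x=\{\mathcal F_1(x),\mathcal F_1(x^*)\}\star\cdots\star\{\mathcal F_k(x),\mathcal F_k(x^*)\}\subseteq (K_{B_n})_I ,$$ the boundary complex of a $k$-dimensional cross-polytope, oriented so that its fundamental cycle is $(\mathcal F_1(x)-\mathcal F_1(x^*))\star\cdots\star(\mathcal F_k(x)-\mathcal F_k(x^*))$ (the empty simplex if $k=0$). Let $[\square_x]\in\widetilde H_{\lfloor\frac{r-1}{2}\rfloor}((K_{B_n})_I)$ be the class of this cycle. Then the classes $[\square_x]$, for $x$ ranging over the $B$-snakes on $I$, form a $\mathbb Q$-basis of $\widetilde H_{\lfloor\frac{r-1}{2}\rfloor}((K_{B_n})_I)$. -/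

import Mathlib

noncomputable section

namespace TypeB

/-! ### Reduced rational simplicial homology

Simplicial complexes are Mathlib's `PreAbstractSimplicialComplex` (whose faces are non-empty).
The vertices carry a partial order for which the vertices of every face are pairwise comparable
(faces of `coxeterComplex` are chains of sets), so that each face is oriented by listing its
vertices in increasing order. -/

/-- The faces of `K` together with the empty face. -/
@[ext]
structure AugFace {V : Type*} (K : PreAbstractSimplicialComplex V) where
  /-- The vertices of the face. -/
  verts : Finset V
  eq_empty_or_mem : verts = ∅ ∨ verts ∈ K.faces

/-- The augmented simplicial chains of `K` with rational coefficients, in all degrees. -/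
abbrev Chains {V : Type*} (K : PreAbstractSimplicialComplex V) : Type _ := AugFace K →₀ ℚ

/-- The face of `s` opposite to the vertex `v`. -/
def AugFace.erase {V : Type*} [DecidableEq V] {K : PreAbstractSimplicialComplex V}
    (s : AugFace K) (v : V) : AugFace K :=
  ⟨s.verts.erase v, by
    rcases s.eq_empty_or_mem with h | h
    · left; simp [h]
    · by_cases h' : s.verts.erase v = ∅
      · exact Or.inl h'
      · exact Or.inr ((K.isRelLowerSet_faces h).2 (Finset.erase_subset _ _)
          (Finset.nonempty_iff_ne_empty.2 h'))⟩

/-- The boundary operator `∂ ⟨v₀ < ⋯ < v_d⟩ = ∑ i, (-1) ^ i ⟨v₀ < ⋯ v̂ᵢ ⋯ < v_d⟩`; on vertices it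
is the augmentation, and the boundary of the empty face is zero. -/
def boundary {V : Type*} [PartialOrder V] [DecidableEq V] [DecidableLT V]
    (K : PreAbstractSimplicialComplex V) : Chains K →ₗ[ℚ] Chains K :=
  Finsupp.linearCombination ℚ fun s : AugFace K =>
    ∑ v ∈ s.verts, Finsupp.single (s.erase v) ((-1 : ℚ) ^ (s.verts.filter (· < v)).card)

/-- Chains of degree `d`: combinations of faces with `d + 1` vertices (`d = -1`: the empty face). -/
def chainsOfDegree {V : Type*} (K : PreAbstractSimplicialComplex V) (d : ℤ) :
    Submodule ℚ (Chains K) :=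
  Finsupp.supported ℚ ℚ {s : AugFace K | (s.verts.card : ℤ) = d + 1}

/-- Cycles of degree `d`. -/
def cycles {V : Type*} [PartialOrder V] [DecidableEq V] [DecidableLT V]
    (K : PreAbstractSimplicialComplex V) (d : ℤ) : Submodule ℚ (Chains K) :=
  chainsOfDegree K d ⊓ LinearMap.ker (boundary K)

/-- Boundaries of degree `d`. -/
def boundaries {V : Type*} [PartialOrder V] [DecidableEq V] [DecidableLT V]
    (K : PreAbstractSimplicialComplex V) (d : ℤ) : Submodule ℚ (Chains K) :=
  (chainsOfDegree K (d + 1)).map (boundary K)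

/-- Reduced homology with rational coefficients in degree `d`: cycles modulo boundaries. -/
abbrev ReducedHomology {V : Type*} [PartialOrder V] [DecidableEq V] [DecidableLT V]
    (K : PreAbstractSimplicialComplex V) (d : ℤ) : Type _ :=
  cycles K d ⧸ (boundaries K d).submoduleOf (cycles K d)

/-- The full subcomplex of `K` on the vertices satisfying `P`. -/
def fullSubcomplex {V : Type*} (K : PreAbstractSimplicialComplex V) (P : V → Prop) :
    PreAbstractSimplicialComplex V where
  faces := {s | s ∈ K.faces ∧ ∀ v ∈ s, P v}
  isRelLowerSet_faces := fun _ hs =>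
    ⟨(K.isRelLowerSet_faces hs.1).1, fun _ hts ht =>
      ⟨(K.isRelLowerSet_faces hs.1).2 hts ht, fun v hv => hs.2 v (hts hv)⟩⟩

/-- The fundamental chain of the join `{p₀, p₀*} ⋆ ⋯ ⋆ {p_{k-1}, p_{k-1}*}` of `k` pairs of points,
where `pᵢ = p i false` and `pᵢ* = p i true`, i.e. of the boundary complex of the `k`-dimensional
cross-polytope, oriented as the product `(p₀ - p₀*) ⋆ ⋯ ⋆ (p_{k-1} - p_{k-1}*)`.
(For `k = 0` it is the empty face with coefficient one.) -/
def crossPolytopeChain {V : Type*} [DecidableEq V] (K : PreAbstractSimplicialComplex V) {k : ℕ}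
    (p : Fin k → Bool → V)
    (hp : ∀ ε : Fin k → Bool, Finset.univ.image (fun i => p i (ε i)) = ∅ ∨
      Finset.univ.image (fun i => p i (ε i)) ∈ K.faces) : Chains K :=
  ∑ ε : Fin k → Bool,
    Finsupp.single (⟨Finset.univ.image (fun i => p i (ε i)), hp ε⟩ : AugFace K)
      (∏ i, if ε i then (-1 : ℚ) else 1)

theorem crossPolytopeChain_mem_cycles {V : Type*} [PartialOrder V] [DecidableEq V] [DecidableLT V]
    (K : PreAbstractSimplicialComplex V) {k : ℕ} (p : Fin k → Bool → V)
    (hp : ∀ ε : Fin k → Bool, Finset.univ.image (fun i => p i (ε i)) = ∅ ∨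
      Finset.univ.image (fun i => p i (ε i)) ∈ K.faces)
    (hmono : ∀ ε : Fin k → Bool, StrictMono fun i => p i (ε i)) {d : ℤ} (hd : (k : ℤ) = d + 1) :
    crossPolytopeChain K p hp ∈ cycles K d := by
  refine ⟨?_, ?_⟩
  · refine Submodule.sum_mem _ fun ε _ => Finsupp.single_mem_supported ℚ _ ?_
    change ((Finset.univ.image (fun i => p i (ε i))).card : ℤ) = d + 1
    rw [Finset.card_image_of_injective _ (hmono ε).injective, Finset.card_univ, Fintype.card_fin]
    exact hd
  · change boundary K (crossPolytopeChain K p hp) = 0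
    rw [crossPolytopeChain, map_sum]
    have key : ∀ ε : Fin k → Bool,
        boundary K (Finsupp.single (⟨Finset.univ.image (fun i => p i (ε i)), hp ε⟩ : AugFace K)
          (∏ i, if ε i then (-1 : ℚ) else 1)) =
        ∑ i : Fin k, Finsupp.single
          (AugFace.erase (⟨Finset.univ.image (fun i => p i (ε i)), hp ε⟩ : AugFace K) (p i (ε i)))
          ((∏ i, if ε i then (-1 : ℚ) else 1) * (-1) ^ (i : ℕ)) := by
      intro ε
      rw [boundary, Finsupp.linearCombination_single, Finset.smul_sum,
        Finset.sum_image (fun a _ b _ h => (hmono ε).injective h)]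
      refine Finset.sum_congr rfl fun i _ => ?_
      rw [Finsupp.smul_single, smul_eq_mul]
      congr 3
      rw [Finset.filter_image, Finset.card_image_of_injective _ (hmono ε).injective]
      have : (Finset.univ.filter fun a : Fin k => p a (ε a) < p i (ε i)) = Finset.Iio i := by
        ext a
        simp [(hmono ε).lt_iff_lt]
      rw [this, Fin.card_Iio]
    simp_rw [key]
    rw [← Finset.sum_product']
    refine Finset.sum_involution
      (fun a _ => (Function.update a.1 a.2 (!(a.1 a.2)), a.2)) ?_ ?_ ?_ ?_
    · rintro ⟨ε, i⟩ -
      have h1 : AugFace.erase (⟨Finset.univ.image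
            (fun j => p j (Function.update ε i (!(ε i)) j)), hp _⟩ : AugFace K)
            (p i (Function.update ε i (!(ε i)) i)) =
          AugFace.erase (⟨Finset.univ.image (fun j => p j (ε j)), hp ε⟩ : AugFace K)
            (p i (ε i)) := by
        apply AugFace.ext
        change (Finset.univ.image
            (fun j => p j (Function.update ε i (!(ε i)) j))).erase
            (p i (Function.update ε i (!(ε i)) i)) =
          (Finset.univ.image (fun j => p j (ε j))).erase (p i (ε i))
        rw [← Finset.image_erase (hmono (Function.update ε i (!(ε i)))).injective,
          ← Finset.image_erase (hmono ε).injective]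
        refine Finset.image_congr fun j hj => ?_
        have : j ≠ i := by simpa using hj
        simp [Function.update_of_ne this]
      have h2 : (∏ j, if Function.update ε i (!(ε i)) j then (-1 : ℚ) else 1) =
          - ∏ j, if ε j then (-1 : ℚ) else 1 := by
        rw [← Finset.mul_prod_erase _ _ (Finset.mem_univ i),
          ← Finset.mul_prod_erase (a := i) (s := Finset.univ)
            (f := fun j => if ε j then (-1 : ℚ) else 1) (h := Finset.mem_univ i)]
        have : (∏ j ∈ Finset.univ.erase i,
              if Function.update ε i (!(ε i)) j then (-1 : ℚ) else 1) =
            ∏ j ∈ Finset.univ.erase i, if ε j then (-1 : ℚ) else 1 := by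
          refine Finset.prod_congr rfl fun j hj => ?_
          rw [Function.update_of_ne (Finset.ne_of_mem_erase hj)]
        rw [this]
        cases h : ε i <;> simp
      simp only [h1, h2, ← Finsupp.single_add]
      simp
    · rintro ⟨ε, i⟩ - - h
      have := congrFun (congrArg Prod.fst h) i
      simp at this
    · intro a _
      simp
    · rintro ⟨ε, i⟩ -
      simp

/-! ### The Coxeter complex of type `B` and its full subcomplexes -/

/-- Vertices of the Coxeter complex of type `Bₙ`: non-empty subsets of
`[±n] = {±1, …, ±n}` which do not contain both `i` and `-i` for any `i`. -/
def IsVertex (n : ℕ) (L : Finset ℤ) : Prop :=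
  L.Nonempty ∧ (∀ i ∈ L, i.natAbs ∈ Finset.Icc 1 n) ∧ ∀ i ∈ L, -i ∉ L

/-- The Coxeter complex of type `Bₙ`: its faces are the nested chains of vertices. -/
def coxeterComplex (n : ℕ) : PreAbstractSimplicialComplex (Finset ℤ) where
  faces := {s | s.Nonempty ∧ (∀ L ∈ s, IsVertex n L) ∧
    ∀ L ∈ s, ∀ L' ∈ s, L ⊆ L' ∨ L' ⊆ L}
  isRelLowerSet_faces := fun _ hs =>
    ⟨hs.1, fun _ hts ht => ⟨ht, fun L hL => hs.2.1 L (hts hL),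
      fun L hL L' hL' => hs.2.2 L (hts hL) L' (hts hL')⟩⟩

/-- The vertices `J` for which the number of `i ∈ I` with `i ∈ J` or `-i ∈ J` is odd. -/
def IsOddVertex (I : Finset ℕ) (J : Finset ℤ) : Prop :=
  Odd (I.filter fun i : ℕ => (i : ℤ) ∈ J ∨ -(i : ℤ) ∈ J).card

/-- The full subcomplex of the Coxeter complex of type `Bₙ` attached to `I ⊆ [n]`. -/
def coxeterSubcomplex (n : ℕ) (I : Finset ℕ) : PreAbstractSimplicialComplex (Finset ℤ) :=
  fullSubcomplex (coxeterComplex n) (IsOddVertex I)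

/-! ### Signed permutations and snakes -/

/-- Signed permutations on `I`: maps `x : I → ℤ` with `|x i| ∈ I` for all `i` and
`|x i| ≠ |x j|` for `i ≠ j`. -/
structure SignedPerm (I : Finset ℕ) where
  /-- The underlying map. -/
  toFun : I → ℤ
  natAbs_mem : ∀ i, (toFun i).natAbs ∈ I
  natAbs_injective : Function.Injective fun i => (toFun i).natAbs

/-- The `j`-th letter `x_j` (`1 ≤ j ≤ r = |I|`) of the word `x = x_r ⋯ x₂ x₁`, which lists the
values of `x` at the elements of `I` in increasing order: `x_r` is the value at the smallest
element of `I` and `x₁` the value at the largest. The junk value outside the range is `0`. -/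
def SignedPerm.letter {I : Finset ℕ} (x : SignedPerm I) (j : ℕ) : ℤ :=
  if h : 1 ≤ j ∧ j ≤ I.card then x.toFun (I.orderIsoOfFin rfl ⟨I.card - j, by omega⟩) else 0

/-- `B`-snakes: `0 < x_r > x_{r-1} < x_{r-2} > ⋯ x₁`. -/
def SignedPerm.IsBSnake {I : Finset ℕ} (x : SignedPerm I) : Prop :=
  (1 ≤ I.card → 0 < x.letter I.card) ∧
  ∀ j, 1 ≤ j → j < I.card →
    (Odd (I.card - j) → x.letter j < x.letter (j + 1)) ∧
    (Even (I.card - j) → x.letter (j + 1) < x.letter j)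

/-- The word of `x*` in terms of the word `w` of `x`: the letters at the positions `2i - 1` and `2i`
are exchanged for all `i ≤ r / 2`, and if `r` is odd, the letter at position `r` is negated. -/
def starWord (r : ℕ) (w : ℕ → ℤ) (j : ℕ) : ℤ :=
  if Even j then w (j - 1) else if j = r then -w j else w (j + 1)

/-- The set `F_i` of a word `x_r ⋯ x₁`, which is `{x₁, …, x_{2i-1}}` if `r` is odd and
`{-x₁, …, -x_{2i-1}}` if `r` is even. -/
def prefixSet (r : ℕ) (w : ℕ → ℤ) (i : ℕ) : Finset ℤ :=
  (Finset.Icc 1 (2 * i - 1)).image fun j => if Odd r then w j else -w j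

/-- The vertices `F_i(x)` (for `b = false`) and `F_i(x*)` (for `b = true`). -/
def SignedPerm.vertex {I : Finset ℕ} (x : SignedPerm I) (i : ℕ) (b : Bool) : Finset ℤ :=
  prefixSet I.card (if b then starWord I.card x.letter else x.letter) i

theorem SignedPerm.letter_mem {I : Finset ℕ} (x : SignedPerm I) {j : ℕ} (h1 : 1 ≤ j)
    (h2 : j ≤ I.card) : (x.letter j).natAbs ∈ I := by
  rw [SignedPerm.letter, dif_pos ⟨h1, h2⟩]
  exact x.natAbs_mem _

theorem SignedPerm.letter_inj {I : Finset ℕ} (x : SignedPerm I) {j j' : ℕ} (h1 : 1 ≤ j)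
    (h2 : j ≤ I.card) (h1' : 1 ≤ j') (h2' : j' ≤ I.card)
    (h : (x.letter j).natAbs = (x.letter j').natAbs) : j = j' := by
  rw [SignedPerm.letter, SignedPerm.letter, dif_pos ⟨h1, h2⟩, dif_pos ⟨h1', h2'⟩] at h
  have := Fin.mk.inj ((I.orderIsoOfFin rfl).injective (x.natAbs_injective h))
  omega

theorem starWord_natAbs (r : ℕ) (w : ℕ → ℤ) (j : ℕ) :
    (starWord r w j).natAbs = (w (if Even j then j - 1 else if j = r then j else j + 1)).natAbs := by
  unfold starWord
  split_ifs <;> simp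

theorem prefixSet_spec {I : Finset ℕ} {n : ℕ} (hI : I ⊆ Finset.Icc 1 n) (u : ℕ → ℤ)
    (hu : ∀ j, 1 ≤ j → j ≤ I.card → (u j).natAbs ∈ I)
    (hinj : ∀ j j', 1 ≤ j → j ≤ I.card → 1 ≤ j' → j' ≤ I.card →
      (u j).natAbs = (u j').natAbs → j = j') {i : ℕ} (hi : 1 ≤ i) (hi' : 2 * i - 1 ≤ I.card) :
    IsVertex n (prefixSet I.card u i) ∧ IsOddVertex I (prefixSet I.card u i) ∧
      (prefixSet I.card u i).card = 2 * i - 1 := by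
  set v : ℕ → ℤ := fun j => if Odd I.card then u j else -u j with hv
  have hva : ∀ j, (v j).natAbs = (u j).natAbs := by
    intro j; simp only [hv]; split_ifs <;> simp
  have hmem : ∀ e, e ∈ prefixSet I.card u i ↔ ∃ j, (1 ≤ j ∧ j ≤ 2 * i - 1) ∧ v j = e := by
    intro e; simp [prefixSet, hv]
  have hinj' : Set.InjOn (fun j => (u j).natAbs) (Finset.Icc 1 (2 * i - 1)) := by
    intro a ha b hb h
    simp only [Finset.coe_Icc, Set.mem_Icc] at ha hb
    exact hinj a b ha.1 (by omega) hb.1 (by omega) h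
  refine ⟨⟨?_, ?_, ?_⟩, ?_, ?_⟩
  · exact ⟨v 1, (hmem _).2 ⟨1, ⟨le_rfl, by omega⟩, rfl⟩⟩
  · intro e he
    obtain ⟨j, hj, rfl⟩ := (hmem e).1 he
    rw [hva]
    exact hI (hu j hj.1 (by omega))
  · intro e he he'
    obtain ⟨j, hj, rfl⟩ := (hmem e).1 he
    obtain ⟨j', hj', h⟩ := (hmem _).1 he'
    have h3 : (u j').natAbs = (u j).natAbs := by rw [← hva, ← hva, h, Int.natAbs_neg]
    have := hinj j' j hj'.1 (by omega) hj.1 (by omega) h3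
    subst this
    have h0 : v j' = 0 := by omega
    have h4 := hI (hu j' hj.1 (by omega))
    rw [← hva, h0] at h4
    simp at h4
  · have : (I.filter fun e : ℕ => (e : ℤ) ∈ prefixSet I.card u i ∨ -(e : ℤ) ∈ prefixSet I.card u i) =
        (Finset.Icc 1 (2 * i - 1)).image fun j => (u j).natAbs := by
      ext e
      simp only [Finset.mem_filter, hmem, Finset.mem_image, Finset.mem_Icc]
      constructor
      · rintro ⟨-, ⟨j, hj, h⟩ | ⟨j, hj, h⟩⟩
        · exact ⟨j, hj, by rw [← hva, h]; simp⟩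
        · exact ⟨j, hj, by rw [← hva, h]; simp⟩
      · rintro ⟨j, hj, rfl⟩
        refine ⟨hu j hj.1 (by omega), ?_⟩
        rw [← hva]
        rcases Int.natAbs_eq (v j) with h | h
        · exact Or.inl ⟨j, hj, h⟩
        · exact Or.inr ⟨j, hj, h⟩
    rw [IsOddVertex, this, Finset.card_image_of_injOn hinj', Nat.card_Icc]
    exact ⟨i - 1, by omega⟩
  · rw [prefixSet, Finset.card_image_of_injOn, Nat.card_Icc]
    · omega
    · intro a ha b hb h
      refine hinj' ha hb ?_
      have h : v a = v b := h
      simp only [← hva, h]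

theorem SignedPerm.vertex_spec {I : Finset ℕ} {n : ℕ} (hI : I ⊆ Finset.Icc 1 n) (x : SignedPerm I)
    {i : ℕ} (hi : 1 ≤ i) (hi' : 2 * i - 1 ≤ I.card) (b : Bool) :
    IsVertex n (x.vertex i b) ∧ IsOddVertex I (x.vertex i b) ∧
      (x.vertex i b).card = 2 * i - 1 := by
  cases b
  · exact prefixSet_spec hI _ (fun j h1 h2 => x.letter_mem h1 h2)
      (fun j j' h1 h2 h3 h4 h => x.letter_inj h1 h2 h3 h4 h) hi hi'
  · refine prefixSet_spec hI (starWord I.card x.letter) (fun j h1 h2 => ?_)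
      (fun j j' h1 h2 h3 h4 h => ?_) hi hi'
    · rw [starWord_natAbs]
      apply x.letter_mem <;> grind
    · rw [starWord_natAbs, starWord_natAbs] at h
      have := x.letter_inj (by grind) (by grind) (by grind) (by grind) h
      grind

theorem SignedPerm.vertex_ssubset {I : Finset ℕ} {n : ℕ} (hI : I ⊆ Finset.Icc 1 n)
    (x : SignedPerm I) {i i' : ℕ} (hi : 1 ≤ i) (hii' : i < i') (hi' : 2 * i' - 1 ≤ I.card)
    (b b' : Bool) : x.vertex i b ⊂ x.vertex i' b' := by
  have hsub : x.vertex i b ⊆ x.vertex i' b' := by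
    intro e he
    simp only [vertex, prefixSet, Finset.mem_image, Finset.mem_Icc] at he ⊢
    obtain ⟨j, hj, rfl⟩ := he
    have hstar : ∀ w : ℕ → ℤ, starWord I.card w j = w (if Even j then j - 1 else j + 1) := by
      intro w; unfold starWord; grind
    have hstar' : ∀ w : ℕ → ℤ, starWord I.card w (if Even j then j - 1 else j + 1) = w j := by
      intro w; unfold starWord; grind
    cases b <;> cases b'
    · exact ⟨j, by omega, rfl⟩
    · exact ⟨if Even j then j - 1 else j + 1, by grind, by simp [hstar']⟩
    · exact ⟨if Even j then j - 1 else j + 1, by grind, by simp [hstar]⟩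
    · exact ⟨j, by omega, rfl⟩
  refine Finset.ssubset_iff_subset_ne.2 ⟨hsub, fun h => ?_⟩
  have h1 := (x.vertex_spec hI hi (by omega) b).2.2
  have h2 := (x.vertex_spec hI (i := i') (by omega) hi' b').2.2
  rw [h] at h1
  omega

/-! ### The cross-polytope cycles -/

theorem SignedPerm.vertex_strictMono {I : Finset ℕ} {n : ℕ} (hI : I ⊆ Finset.Icc 1 n)
    (x : SignedPerm I) (ε : Fin ((I.card + 1) / 2) → Bool) :
    StrictMono fun i : Fin ((I.card + 1) / 2) => x.vertex (i + 1) (ε i) := by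
  intro i i' h
  have h1 := i'.2
  exact x.vertex_ssubset hI (by omega) (by simpa using h) (by omega) _ _

theorem SignedPerm.vertex_face {I : Finset ℕ} {n : ℕ} (hI : I ⊆ Finset.Icc 1 n)
    (x : SignedPerm I) (ε : Fin ((I.card + 1) / 2) → Bool) :
    Finset.univ.image (fun i : Fin ((I.card + 1) / 2) => x.vertex (i + 1) (ε i)) = ∅ ∨
      Finset.univ.image (fun i : Fin ((I.card + 1) / 2) => x.vertex (i + 1) (ε i)) ∈
        (coxeterSubcomplex n I).faces := by
  rcases Finset.eq_empty_or_nonempty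
    (Finset.univ.image (fun i : Fin ((I.card + 1) / 2) => x.vertex (i + 1) (ε i))) with h | h
  · exact Or.inl h
  · have hs : ∀ i : Fin ((I.card + 1) / 2), _ := fun i =>
      x.vertex_spec hI (i := i + 1) (by omega) (by have := i.2; omega) (ε i)
    refine Or.inr ⟨⟨h, ?_, ?_⟩, ?_⟩
    · intro L hL
      obtain ⟨i, -, rfl⟩ := Finset.mem_image.1 hL
      exact (hs i).1
    · intro L hL L' hL'
      obtain ⟨i, -, rfl⟩ := Finset.mem_image.1 hL
      obtain ⟨i', -, rfl⟩ := Finset.mem_image.1 hL'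
      exact (le_total i i').imp (fun h => (x.vertex_strictMono hI ε).monotone h)
        (fun h => (x.vertex_strictMono hI ε).monotone h)
    · intro L hL
      obtain ⟨i, -, rfl⟩ := Finset.mem_image.1 hL
      exact (hs i).2.1

/-- The fundamental cycle of the cross-polytope
`□ₓ = {F₁(x), F₁(x*)} ⋆ ⋯ ⋆ {F_k(x), F_k(x*)}`, `k = ⌊(r + 1) / 2⌋`. -/
def SignedPerm.crossPolytopeCycle {I : Finset ℕ} {n : ℕ} (hI : I ⊆ Finset.Icc 1 n)
    (x : SignedPerm I) : cycles (coxeterSubcomplex n I) (((I.card : ℤ) - 1) / 2) :=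
  ⟨crossPolytopeChain (coxeterSubcomplex n I)
      (fun (i : Fin ((I.card + 1) / 2)) b => x.vertex (i + 1) b) (x.vertex_face hI),
    crossPolytopeChain_mem_cycles _ _ _ (x.vertex_strictMono hI) (by omega)⟩

/-- The homology class `[□ₓ]`. -/
def SignedPerm.crossPolytopeClass {I : Finset ℕ} {n : ℕ} (hI : I ⊆ Finset.Icc 1 n)
    (x : SignedPerm I) : ReducedHomology (coxeterSubcomplex n I) (((I.card : ℤ) - 1) / 2) :=
  Submodule.Quotient.mk (x.crossPolytopeCycle hI)

end TypeB

end

/-! Write r for the size of I and k for ⌊(r+1)/2⌋. First reduction: replacing a vertex L by its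
letters with absolute value in I does not change the parity condition, so homology can be computed
on chains supported on subsets of ±I. This is carried out at chain level by
`exists_sub_mem_boundaries`, in a relative form: only the boundary of the chain has to be supported
there. The same statement moves a cycle onto subsets of ±I and shows that a boundary supported there
is zero.

On subsets of ±I a vertex has odd size at most r, and the vertices of a face have distinct sizes, so
a face has at most k vertices (`AugFace.card_le`). The degree in question is therefore the top one,
and homology becomes the space of top cycles; it remains to find a basis of that space.

Give a face the weight obtained by adding all letters of all its vertices. The alternating
inequalities of a snake x say exactly that passing from F_i(x) to F_i(x*) lowers the letter sum, so
F_1(x) ⊂ ⋯ ⊂ F_k(x) is the unique face of maximal weight in □ₓ, with coefficient 1. A snake can be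
recovered from this leading face, so the matrix of coefficients of the cycles □ₓ at leading faces is
unitriangular with respect to weight (`leadingCoefficients_comp_injective`). This gives
independence.

For spanning, take a face of maximal weight in the support of a nonzero top cycle. Each of its
ridges lies in another face of the support, whose weight is no larger; the resulting exchanges of
letters (`exists_exchange`) are the inequalities of a snake (`exists_snake`). Hence a top cycle
vanishing at all leading faces of snakes is zero. Subtracting the combination of the □ₓ with the
same leading coefficients finishes the proof. -/

noncomputable section

namespace TypeB

/-! ### Chains, supports and the boundary operator. -/

section Homology

variable {V : Type*} {K : PreAbstractSimplicialComplex V}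

/-- The chains all of whose faces have their vertices in `U`. -/
def supportedOn (K : PreAbstractSimplicialComplex V) (U : Set V) : Submodule ℚ (Chains K) :=
  Finsupp.supported ℚ ℚ {s : AugFace K | ∀ v ∈ s.verts, v ∈ U}

theorem mem_supportedOn {U : Set V} {w : Chains K} :
    w ∈ supportedOn K U ↔ ∀ s : AugFace K, w s ≠ 0 → ∀ v ∈ s.verts, v ∈ U := by
  simp [supportedOn, Finsupp.mem_supported, Set.subset_def]

theorem mem_chainsOfDegree {d : ℤ} {w : Chains K} :
    w ∈ chainsOfDegree K d ↔ ∀ s : AugFace K, w s ≠ 0 → (s.verts.card : ℤ) = d + 1 := by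
  simp [chainsOfDegree, Finsupp.mem_supported, Set.subset_def]

theorem supportedOn_mono {U U' : Set V} (h : U ⊆ U') : supportedOn K U ≤ supportedOn K U' :=
  fun _ hw => mem_supportedOn.2 fun s hs v hv => h (mem_supportedOn.1 hw s hs v hv)

theorem map_mem_of_mem_supported {W : Type*} [AddCommGroup W] [Module ℚ W]
    (f : Chains K →ₗ[ℚ] W) (S : Set (AugFace K)) (N : Submodule ℚ W)
    (h : ∀ s ∈ S, f (Finsupp.single s 1) ∈ N) {w : Chains K}
    (hw : w ∈ Finsupp.supported ℚ ℚ S) : f w ∈ N := by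
  rw [Finsupp.supported_eq_span_single] at hw
  refine Submodule.span_le (p := N.comap f).2 ?_ hw
  rintro _ ⟨s, hs, rfl⟩
  exact h s hs

theorem AugFace.erase_erase_comm [DecidableEq V] (s : AugFace K) (u v : V) :
    (s.erase u).erase v = (s.erase v).erase u :=
  AugFace.ext (Finset.erase_right_comm)

variable [PartialOrder V] [DecidableLT V]

/-- The incidence sign of the vertex `v` in the face `s`. -/
def vertexSign (s : Finset V) (v : V) : ℚ := (-1) ^ (s.filter (· < v)).card

theorem vertexSign_mul_self (s : Finset V) (v : V) : vertexSign s v * vertexSign s v = 1 := by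
  rw [vertexSign, ← mul_pow]; simp

theorem vertexSign_ne_zero (s : Finset V) (v : V) : vertexSign s v ≠ 0 := by
  simp [vertexSign]

variable [DecidableEq V]

theorem vertexSign_erase_of_lt {s : Finset V} {u v : V} (hu : u ∈ s) (h : u < v) :
    vertexSign (s.erase u) v = -vertexSign s v := by
  have h1 : u ∈ s.filter (· < v) := Finset.mem_filter.2 ⟨hu, h⟩
  rw [vertexSign, vertexSign, Finset.filter_erase, ← Finset.card_erase_add_one h1, pow_succ]
  simp

theorem vertexSign_erase_of_not_lt {s : Finset V} {u v : V} (h : ¬ u < v) :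
    vertexSign (s.erase u) v = vertexSign s v := by
  rw [vertexSign, vertexSign, Finset.filter_erase, Finset.erase_eq_of_notMem]
  simp [h]

/-- Deleting the smaller of the two vertices shifts the position of the larger by one, while
deleting the larger leaves the smaller in place. Comparability is essential: for incomparable
vertices neither sign would change. -/
theorem vertexSign_mul_vertexSign_erase {s : Finset V} {u v : V} (hu : u ∈ s) (hv : v ∈ s)
    (h : u < v ∨ v < u) :
    vertexSign s u * vertexSign (s.erase u) v = -(vertexSign s v * vertexSign (s.erase v) u) := by
  rcases h with h | h
  · rw [vertexSign_erase_of_lt hu h, vertexSign_erase_of_not_lt h.not_gt]; ring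
  · rw [vertexSign_erase_of_lt hv h, vertexSign_erase_of_not_lt h.not_gt]; ring

theorem boundary_single (s : AugFace K) (c : ℚ) :
    boundary K (Finsupp.single s c) =
      ∑ v ∈ s.verts, Finsupp.single (s.erase v) (c * vertexSign s.verts v) := by
  rw [boundary, Finsupp.linearCombination_single, Finset.smul_sum]
  simp [vertexSign]

theorem boundary_mem_supportedOn {U : Set V} {w : Chains K} (hw : w ∈ supportedOn K U) :
    boundary K w ∈ supportedOn K U := by
  refine map_mem_of_mem_supported _ _ _ (fun s hs => ?_) hw
  rw [boundary_single]
  refine Submodule.sum_mem _ fun v _ => Finsupp.single_mem_supported ℚ _ fun u hu => ?_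
  exact hs u (Finset.mem_of_mem_erase hu)

theorem boundary_mem_chainsOfDegree {d : ℤ} {w : Chains K} (hw : w ∈ chainsOfDegree K (d + 1)) :
    boundary K w ∈ chainsOfDegree K d := by
  refine map_mem_of_mem_supported _ _ _ (fun s hs => ?_) hw
  rw [boundary_single]
  refine Submodule.sum_mem _ fun v hv => Finsupp.single_mem_supported ℚ _ ?_
  have h1 : (s.verts.card : ℤ) = d + 1 + 1 := hs
  have h2 := Finset.card_erase_add_one hv
  change ((s.verts.erase v).card : ℤ) = d + 1
  omega

/-- The terms deleting u then v and v then u cancel. The vertices of a face must be comparable,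
since the order only supplies orientations on chains. -/
theorem boundary_boundary
    (hK : ∀ s ∈ K.faces, ∀ u ∈ s, ∀ v ∈ s, u ≤ v ∨ v ≤ u) (w : Chains K) :
    boundary K (boundary K w) = 0 := by
  induction w using Finsupp.induction_linear with
  | zero => simp
  | add f g hf hg => simp [hf, hg]
  | single s c =>
    have hs : ∀ u ∈ s.verts, ∀ v ∈ s.verts, u ≠ v → u < v ∨ v < u := by
      intro u hu v hv huv
      rcases s.eq_empty_or_mem with h | h
      · simp [h] at hu
      · rcases hK _ h u hu v hv with h | h
        · exact Or.inl (lt_of_le_of_ne h huv)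
        · exact Or.inr (lt_of_le_of_ne h huv.symm)
    simp_rw [boundary_single, map_sum, boundary_single]
    rw [Finset.sum_sigma']
    refine Finset.sum_involution (fun a _ => ⟨a.2, a.1⟩) ?_ ?_ ?_ ?_
    · rintro ⟨u, v⟩ h
      obtain ⟨hu, hv⟩ := Finset.mem_sigma.1 h
      have hv' : v ∈ s.verts ∧ v ≠ u := ⟨Finset.mem_of_mem_erase hv, Finset.ne_of_mem_erase hv⟩
      have := vertexSign_mul_vertexSign_erase hu hv'.1 (hs u hu v hv'.1 hv'.2.symm)
      simp only
      rw [AugFace.erase_erase_comm s v u, ← Finsupp.single_add, mul_assoc, mul_assoc, ← mul_add]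
      change Finsupp.single _ (c * (vertexSign s.verts u * vertexSign (s.verts.erase u) v +
        vertexSign s.verts v * vertexSign (s.verts.erase v) u)) = 0
      rw [this]; simp
    · rintro ⟨u, v⟩ h - h'
      obtain ⟨hu, hv⟩ := Finset.mem_sigma.1 h
      exact Finset.ne_of_mem_erase hv (congrArg Sigma.fst h')
    · rintro ⟨u, v⟩ h
      obtain ⟨hu, hv⟩ := Finset.mem_sigma.1 h
      have hv' : v ∈ s.verts ∧ v ≠ u := ⟨Finset.mem_of_mem_erase hv, Finset.ne_of_mem_erase hv⟩
      exact Finset.mem_sigma.2 ⟨hv'.1, Finset.mem_erase.2 ⟨hv'.2.symm, hu⟩⟩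
    · rintro ⟨u, v⟩ h
      rfl

/-! ### Cones and the removal of a vertex from a chain. -/

open Classical in
/-- Coning a face with the vertex `a`. The value is zero if the face contains `a` or if the cone
is not a face. -/
def coneFace (K : PreAbstractSimplicialComplex V) (a : V) (s : AugFace K) : Chains K :=
  if h : a ∉ s.verts ∧ insert a s.verts ∈ K.faces then
    Finsupp.single ⟨insert a s.verts, Or.inr h.2⟩ (vertexSign s.verts a) else 0

/-- The linear extension of `coneFace`. -/
def cone (K : PreAbstractSimplicialComplex V) (a : V) : Chains K →ₗ[ℚ] Chains K :=
  Finsupp.linearCombination ℚ (coneFace K a)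

theorem cone_single (a : V) (s : AugFace K) (c : ℚ) :
    cone K a (Finsupp.single s c) = c • coneFace K a s := by
  rw [cone, Finsupp.linearCombination_single]

theorem coneFace_of_mem {a : V} {s : AugFace K} (h : a ∈ s.verts) : coneFace K a s = 0 := by
  rw [coneFace, dif_neg]; simp [h]

theorem coneFace_of_notMem {a : V} {s : AugFace K} (h : a ∉ s.verts)
    (h' : insert a s.verts ∈ K.faces) :
    coneFace K a s = Finsupp.single ⟨insert a s.verts, Or.inr h'⟩ (vertexSign s.verts a) := by
  rw [coneFace, dif_pos ⟨h, h'⟩]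

/-- The cone on a is a contracting homotopy wherever a can be added. If a lies in s, only the
deletion of a survives coning, and it returns s. Otherwise the deletion of a from the cone returns s
and all other terms cancel in pairs. -/
theorem boundary_cone_add_cone_boundary {a : V} {s : AugFace K}
    (hs : insert a s.verts ∈ K.faces) (hcomp : ∀ v ∈ s.verts, v < a ∨ v = a ∨ a < v) :
    boundary K (cone K a (Finsupp.single s 1)) + cone K a (boundary K (Finsupp.single s 1)) =
      Finsupp.single s 1 := by
  simp_rw [boundary_single, map_sum, cone_single, one_mul, one_smul]
  by_cases ha : a ∈ s.verts
  · rw [coneFace_of_mem ha, map_zero, zero_add, Finset.sum_eq_single_of_mem a ha]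
    · have hins : insert a (s.erase a).verts = s.verts := Finset.insert_erase ha
      rw [coneFace_of_notMem (Finset.notMem_erase _ _) (by rwa [hins, ← Finset.insert_eq_of_mem ha]),
        Finsupp.smul_single, smul_eq_mul]
      congr 1
      · exact AugFace.ext hins
      · change vertexSign s.verts a * vertexSign (s.verts.erase a) a = 1
        rw [vertexSign_erase_of_not_lt (lt_irrefl a), vertexSign_mul_self]
    · intro v _ hv
      rw [coneFace_of_mem (Finset.mem_erase.2 ⟨hv.symm, ha⟩), smul_zero]
  · rw [coneFace_of_notMem ha hs, boundary_single, Finset.sum_insert ha]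
    set s' : Finset V := insert a s.verts with hs'
    have hss : s'.erase a = s.verts := Finset.erase_insert ha
    have h0 : vertexSign s.verts a = vertexSign s' a := by
      rw [← hss, vertexSign_erase_of_not_lt (lt_irrefl a)]
    rw [add_assoc, ← Finset.sum_add_distrib, Finset.sum_eq_zero, add_zero]
    · rw [h0, vertexSign_mul_self]
      congr 1
      exact AugFace.ext hss
    · intro v hv
      have hva : v ≠ a := fun h => ha (h ▸ hv)
      have hins : insert a (s.erase v).verts = s'.erase v := by
        rw [hs', Finset.erase_insert_of_ne hva.symm]; rfl
      have hmem : insert a (s.erase v).verts ∈ K.faces := by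
        rw [hins]
        exact (K.isRelLowerSet_faces hs).2 (Finset.erase_subset _ _)
          ⟨a, Finset.mem_erase.2 ⟨hva.symm, Finset.mem_insert_self _ _⟩⟩
      rw [coneFace_of_notMem (fun h => ha (Finset.mem_of_mem_erase h)) hmem, Finsupp.smul_single,
        smul_eq_mul]
      have hface : (AugFace.erase ⟨s', Or.inr hs⟩ v : AugFace K) =
          ⟨insert a (s.erase v).verts, Or.inr hmem⟩ := AugFace.ext hins.symm
      rw [hface, ← Finsupp.single_add]
      have h1 : vertexSign (s.erase v).verts a = vertexSign (s'.erase v) a := by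
        rw [← hins, ← vertexSign_erase_of_not_lt (s := insert a (s.erase v).verts) (lt_irrefl a),
          Finset.erase_insert (fun h : a ∈ (s.erase v).verts => ha (Finset.mem_of_mem_erase h))]
      have h2 := vertexSign_mul_vertexSign_erase (s := s') (u := a) (v := v)
        (Finset.mem_insert_self _ _) (Finset.mem_insert_of_mem hv)
        (by rcases hcomp v hv with h | h | h
            exacts [Or.inr h, absurd h hva, Or.inl h])
      rw [hss] at h2
      change Finsupp.single _ (vertexSign s.verts a * vertexSign s' v +
        vertexSign s.verts v * vertexSign (s.erase v).verts a) = 0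
      rw [h0, h1]
      have h3 : vertexSign s' a * vertexSign s' v + vertexSign s.verts v * vertexSign (s'.erase v) a
          = 0 := by
        have h4 := vertexSign_mul_self s' a
        -- The relation `h2` is multiplied by two signs; the other multiples remove the squares of
        -- signs, which equal 1.
        linear_combination (vertexSign s' a * vertexSign (s'.erase v) a) * h2 -
          (vertexSign s.verts v * vertexSign (s'.erase v) a) * h4 -
          (vertexSign s' a * vertexSign s' v) * (vertexSign_mul_self (s'.erase v) a)
      rw [h3, Finsupp.single_zero]

theorem cone_mem_supportedOn {U : Set V} (a : V) {w : Chains K} (hw : w ∈ supportedOn K U) :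
    cone K a w ∈ supportedOn K (insert a U) := by
  refine map_mem_of_mem_supported _ _ _ (fun s hs => ?_) hw
  rw [cone_single, one_smul, coneFace]
  split_ifs with h
  · refine Finsupp.single_mem_supported ℚ _ fun u hu => ?_
    rcases Finset.mem_insert.1 hu with rfl | hu
    exacts [Set.mem_insert _ _, Set.mem_insert_of_mem _ (hs u hu)]
  · exact Submodule.zero_mem _

theorem cone_mem_chainsOfDegree {d : ℤ} (a : V) {w : Chains K} (hw : w ∈ chainsOfDegree K d) :
    cone K a w ∈ chainsOfDegree K (d + 1) := by
  refine map_mem_of_mem_supported _ _ _ (fun s hs => ?_) hw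
  rw [cone_single, one_smul, coneFace]
  split_ifs with h
  · refine Finsupp.single_mem_supported ℚ _ ?_
    have h1 : (s.verts.card : ℤ) = d + 1 := hs
    change ((insert a s.verts).card : ℤ) = d + 1 + 1
    rw [Finset.card_insert_of_notMem h.1]
    push_cast
    omega
  · exact Submodule.zero_mem _

/-- A vertex `L` whose link lies in the star of another vertex `a` can be removed from a chain
whose boundary avoids `L`, without changing the chain modulo boundaries. -/
theorem exists_sub_mem_boundaries_of_star {d : ℤ} {U : Set V} {w : Chains K} {L a : V}
    (hLa : a ≠ L) (hd : w ∈ chainsOfDegree K d) (hU : w ∈ supportedOn K U)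
    (hstar : ∀ s : AugFace K, w s ≠ 0 → L ∈ s.verts →
      insert a s.verts ∈ K.faces ∧ ∀ v ∈ s.verts, v < a ∨ v = a ∨ a < v)
    (hL : boundary K w ∈ supportedOn K {L}ᶜ) :
    ∃ w' ∈ chainsOfDegree K d, w - w' ∈ boundaries K d ∧
      w' ∈ supportedOn K (insert a U \ {L}) := by
  classical
  set p : AugFace K → Prop := fun s => L ∈ s.verts with hp
  set w₁ : Chains K := w.filter p with hw₁
  set w₂ : Chains K := w.filter fun s => ¬ p s with hw₂
  have hw : w₁ + w₂ = w := Finsupp.filter_add_filter_not w p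
  have happ₁ : ∀ s, w₁ s ≠ 0 → p s ∧ w s ≠ 0 := by
    intro s hs
    by_cases h : p s
    · exact ⟨h, by rwa [hw₁, Finsupp.filter_apply_pos _ _ h] at hs⟩
    · exact absurd (Finsupp.filter_apply_neg p _ h) hs
  have happ₂ : ∀ s, w₂ s ≠ 0 → ¬ p s ∧ w s ≠ 0 := by
    intro s hs
    by_cases h : p s
    · exact absurd (Finsupp.filter_apply_neg (fun s => ¬ p s) _ (not_not.2 h)) hs
    · exact ⟨h, by rwa [hw₂, Finsupp.filter_apply_pos (fun s => ¬ p s) _ h] at hs⟩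
  have hd₁ : w₁ ∈ chainsOfDegree K d :=
    mem_chainsOfDegree.2 fun s hs => mem_chainsOfDegree.1 hd s (happ₁ s hs).2
  have hU₁ : w₁ ∈ supportedOn K U :=
    mem_supportedOn.2 fun s hs => mem_supportedOn.1 hU s (happ₁ s hs).2
  have hU₂ : w₂ ∈ supportedOn K U :=
    mem_supportedOn.2 fun s hs => mem_supportedOn.1 hU s (happ₂ s hs).2
  have hL₂ : w₂ ∈ supportedOn K {L}ᶜ :=
    mem_supportedOn.2 fun s hs v hv h => (happ₂ s hs).1 (show L ∈ s.verts from Set.mem_singleton_iff.1 h ▸ hv)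
  -- Faces through L in the boundary can only come from `w₁`, so they cancel already there.
  have hL₁ : boundary K w₁ ∈ supportedOn K {L}ᶜ := by
    have : boundary K w₁ = boundary K w - boundary K w₂ := by rw [← hw, map_add]; abel
    rw [this]
    exact Submodule.sub_mem _ hL (boundary_mem_supportedOn hL₂)
  have hcone : boundary K (cone K a w₁) + cone K a (boundary K w₁) = w₁ := by
    have : w₁ ∈ Finsupp.supported ℚ ℚ {s : AugFace K | w₁ s ≠ 0} := by
      simp [Finsupp.mem_supported, Set.subset_def]
    have h := map_mem_of_mem_supported
      ((boundary K) ∘ₗ (cone K a) + (cone K a) ∘ₗ (boundary K) - LinearMap.id) _ ⊥ (fun s hs => ?_)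
      this
    · exact sub_eq_zero.1 ((Submodule.mem_bot ℚ).1 h)
    · obtain ⟨h1, h2⟩ := hstar s (happ₁ s hs).2 (happ₁ s hs).1
      exact (Submodule.mem_bot ℚ).2 (sub_eq_zero.2 (boundary_cone_add_cone_boundary h1 h2))
  have hb : cone K a w₁ ∈ chainsOfDegree K (d + 1) := cone_mem_chainsOfDegree a hd₁
  -- The homotopy trades `w₁` for the cone on its boundary. Neither summand on the right involves L,
  -- because a ≠ L.
  have heq : w - boundary K (cone K a w₁) = w₂ + cone K a (boundary K w₁) := by
    rw [← hw]
    nth_rewrite 1 [← hcone]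
    abel
  refine ⟨w - boundary K (cone K a w₁), Submodule.sub_mem _ hd (boundary_mem_chainsOfDegree hb),
    ?_, ?_⟩
  · rw [sub_sub_cancel]
    exact Submodule.mem_map_of_mem hb
  · have h1 : w - boundary K (cone K a w₁) ∈ supportedOn K (insert a U) := by
      rw [heq]
      exact Submodule.add_mem _ (supportedOn_mono (Set.subset_insert _ _) hU₂)
        (cone_mem_supportedOn a (boundary_mem_supportedOn hU₁))
    have h2 : w - boundary K (cone K a w₁) ∈ supportedOn K {L}ᶜ := by
      rw [heq]
      refine Submodule.add_mem _ hL₂ (supportedOn_mono ?_ (cone_mem_supportedOn a hL₁))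
      exact Set.insert_subset (by simpa using hLa) le_rfl
    exact mem_supportedOn.2 fun s hs v hv =>
      ⟨mem_supportedOn.1 h1 s hs v hv, mem_supportedOn.1 h2 s hs v hv⟩

/-- In a cycle, each ridge of a face of the support lies in a second face of the support. -/
theorem exists_ne_of_boundary_eq_zero {z : Chains K} (hz : boundary K z = 0) {s : AugFace K}
    (hs : z s ≠ 0) {v : V} (hv : v ∈ s.verts) :
    ∃ s' : AugFace K, z s' ≠ 0 ∧ s' ≠ s ∧ ∃ u ∈ s'.verts,
      s'.verts.erase u = s.verts.erase v := by
  by_contra! hcon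
  -- If no other face of the support had this ridge, the coefficient of the boundary at the ridge
  -- would be a single nonzero term.
  have h1 : boundary K z (s.erase v) = z s * vertexSign s.verts v := by
    have h2 : boundary K z = z.sum fun s' c => boundary K (Finsupp.single s' c) := by
      conv_lhs => rw [← Finsupp.sum_single z]
      rw [Finsupp.sum, map_sum]; rfl
    rw [h2, Finsupp.sum, Finsupp.finsetSum_apply,
      Finset.sum_eq_single_of_mem s (Finsupp.mem_support_iff.2 hs), boundary_single,
      Finsupp.finsetSum_apply, Finset.sum_eq_single_of_mem v hv, Finsupp.single_eq_same]
    · intro u hu huv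
      refine Finsupp.single_eq_of_ne fun h => huv ?_
      have h3 : s.verts.erase v = s.verts.erase u := congrArg AugFace.verts h
      by_contra
      have : u ∈ s.verts.erase v := Finset.mem_erase.2 ⟨huv, hu⟩
      rw [h3] at this
      simp at this
    · intro s' hs' hne
      rw [boundary_single, Finsupp.finsetSum_apply]
      refine Finset.sum_eq_zero fun u hu => Finsupp.single_eq_of_ne fun h => ?_
      exact hcon s' (Finsupp.mem_support_iff.1 hs') hne u hu (congrArg AugFace.verts h).symm
  rw [hz] at h1
  exact mul_ne_zero hs (vertexSign_ne_zero _ _) h1.symm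

end Homology

/-! ### Restriction to the letters of `I` -/

section Coxeter

variable {n : ℕ} {I : Finset ℕ}

/-- The signed sets all of whose letters have their absolute values in `I`. -/
def signedSets (I : Finset ℕ) : Set (Finset ℤ) := {L | ∀ e ∈ L, e.natAbs ∈ I}

/-- The letters of `L` with absolute values in `I`. -/
def restrictLetters (I : Finset ℕ) (L : Finset ℤ) : Finset ℤ := L.filter fun e => e.natAbs ∈ I

theorem restrictLetters_subset (L : Finset ℤ) : restrictLetters I L ⊆ L := Finset.filter_subset _ _

theorem restrictLetters_mem (L : Finset ℤ) : restrictLetters I L ∈ signedSets I :=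
  fun _ he => (Finset.mem_filter.1 he).2

theorem subset_restrictLetters {L M : Finset ℤ} (hM : M ∈ signedSets I) (h : M ⊆ L) :
    M ⊆ restrictLetters I L :=
  fun e he => Finset.mem_filter.2 ⟨h he, hM e he⟩

theorem isOddVertex_restrictLetters {L : Finset ℤ} (h : IsOddVertex I L) :
    IsOddVertex I (restrictLetters I L) := by
  rw [IsOddVertex] at h ⊢
  convert h using 2
  refine Finset.filter_congr fun i hi => ?_
  simp [restrictLetters, hi]

theorem IsOddVertex.nonempty {L : Finset ℤ} (h : IsOddVertex I L) : L.Nonempty := by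
  rw [Finset.nonempty_iff_ne_empty]
  rintro rfl
  simp [IsOddVertex] at h

theorem IsVertex.mono {L M : Finset ℤ} (h : IsVertex n L) (hM : M.Nonempty) (hML : M ⊆ L) :
    IsVertex n M :=
  ⟨hM, fun i hi => h.2.1 i (hML hi), fun i hi hi' => h.2.2 i (hML hi) (hML hi')⟩

theorem IsVertex.injOn_natAbs {L : Finset ℤ} (h : IsVertex n L) :
    Set.InjOn Int.natAbs (L : Set ℤ) := by
  intro a ha b hb hab
  rcases Int.natAbs_eq_natAbs_iff.1 hab with h1 | h1
  · exact h1
  · exact absurd (h1 ▸ ha) (h.2.2 b hb)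

/-- Absolute value is injective on L and lands in I, so the number whose parity defines an odd
vertex is the size of L. -/
theorem card_odd_and_le {L : Finset ℤ} (hv : IsVertex n L) (ho : IsOddVertex I L)
    (hL : L ∈ signedSets I) : Odd L.card ∧ L.card ≤ I.card := by
  have h1 : (I.filter fun i : ℕ => (i : ℤ) ∈ L ∨ -(i : ℤ) ∈ L) = L.image Int.natAbs := by
    ext e
    simp only [Finset.mem_filter, Finset.mem_image]
    constructor
    · rintro ⟨-, h | h⟩
      exacts [⟨_, h, by simp⟩, ⟨_, h, by simp⟩]
    · rintro ⟨a, ha, rfl⟩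
      refine ⟨hL a ha, ?_⟩
      rcases Int.natAbs_eq a with h | h
      · exact Or.inl (h ▸ ha)
      · exact Or.inr (h ▸ ha)
  have h2 : (L.image Int.natAbs).card = L.card := Finset.card_image_of_injOn hv.injOn_natAbs
  rw [IsOddVertex, h1, h2] at ho
  refine ⟨ho, ?_⟩
  rw [← h2, ← h1]
  exact Finset.card_filter_le _ _

theorem mem_coxeterSubcomplex {s : Finset (Finset ℤ)} :
    s ∈ (coxeterSubcomplex n I).faces ↔ s.Nonempty ∧
      (∀ L ∈ s, IsVertex n L ∧ IsOddVertex I L) ∧ ∀ L ∈ s, ∀ L' ∈ s, L ⊆ L' ∨ L' ⊆ L := by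
  constructor
  · rintro ⟨⟨h1, h2, h3⟩, h4⟩
    exact ⟨h1, fun L hL => ⟨h2 L hL, h4 L hL⟩, h3⟩
  · rintro ⟨h1, h2, h3⟩
    exact ⟨⟨h1, fun L hL => (h2 L hL).1, h3⟩, fun L hL => (h2 L hL).2⟩

theorem AugFace.isVertex (s : AugFace (coxeterSubcomplex n I)) {L : Finset ℤ} (hL : L ∈ s.verts) :
    IsVertex n L ∧ IsOddVertex I L := by
  rcases s.eq_empty_or_mem with h | h
  · simp [h] at hL
  · exact (mem_coxeterSubcomplex.1 h).2.1 L hL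

theorem AugFace.subset_total (s : AugFace (coxeterSubcomplex n I)) {L L' : Finset ℤ}
    (hL : L ∈ s.verts) (hL' : L' ∈ s.verts) : L ⊆ L' ∨ L' ⊆ L := by
  rcases s.eq_empty_or_mem with h | h
  · simp [h] at hL
  · exact (mem_coxeterSubcomplex.1 h).2.2 L hL L' hL'

theorem AugFace.eq_of_card_eq (s : AugFace (coxeterSubcomplex n I)) {L L' : Finset ℤ}
    (hL : L ∈ s.verts) (hL' : L' ∈ s.verts) (h : L.card = L'.card) : L = L' := by
  rcases s.subset_total hL hL' with h' | h'
  · exact Finset.eq_of_subset_of_card_le h' h.ge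
  · exact (Finset.eq_of_subset_of_card_le h' h.le).symm

theorem boundary_boundary_coxeter (w : Chains (coxeterSubcomplex n I)) :
    boundary (coxeterSubcomplex n I) (boundary (coxeterSubcomplex n I) w) = 0 :=
  boundary_boundary (fun _ hs u hu v hv => (mem_coxeterSubcomplex.1 hs).2.2 u hu v hv) w

/-- Induction on a finite set B of vertices that may leave ±I. A smallest L in B is removed by
coning with its restriction to ±I, which introduces no new vertex outside ±I. -/
theorem exists_sub_mem_boundaries_aux {d : ℤ} (m : ℕ) (B : Finset (Finset ℤ)) (hm : B.card = m)
    (w : Chains (coxeterSubcomplex n I)) (hd : w ∈ chainsOfDegree _ d)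
    (hw : w ∈ supportedOn _ (signedSets I ∪ B))
    (hb : boundary _ w ∈ supportedOn (coxeterSubcomplex n I) (signedSets I)) :
    ∃ w' ∈ chainsOfDegree (coxeterSubcomplex n I) d, w - w' ∈ boundaries _ d ∧
      w' ∈ supportedOn (coxeterSubcomplex n I) (signedSets I) := by
  induction m generalizing B w with
  | zero =>
    rw [Finset.card_eq_zero] at hm
    subst hm
    exact ⟨w, hd, by simp, by simpa using hw⟩
  | succ m ih =>
    have hB : B.Nonempty := Finset.card_pos.1 (by omega)
    obtain ⟨L, hL, hmin⟩ := B.exists_min_image Finset.card hB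
    have hcard : (B.erase L).card = m := by rw [Finset.card_erase_of_mem hL]; omega
    by_cases hLI : L ∈ signedSets I
    · refine ih (B.erase L) hcard w hd (supportedOn_mono ?_ hw) hb
      rintro M (hM | hM)
      · exact Or.inl hM
      · by_cases h : M = L
        · exact Or.inl (h ▸ hLI)
        · exact Or.inr (Finset.mem_coe.2 (Finset.mem_erase.2 ⟨h, hM⟩))
    have haL : restrictLetters I L ≠ L := fun h => hLI (h ▸ restrictLetters_mem L)
    -- Since L is smallest in B, a vertex strictly below L uses only letters of ±I and lies in the
    -- restriction of L; L and the vertices above it contain that restriction. Hence adding the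
    -- restriction keeps the face a chain.
    have key : ∀ s : AugFace (coxeterSubcomplex n I), w s ≠ 0 → L ∈ s.verts →
        ∀ M ∈ s.verts, M ⊆ restrictLetters I L ∨ restrictLetters I L ⊆ M := by
      intro s hs hLs M hM
      rcases s.subset_total hM hLs with h | h
      · by_cases hML : M = L
        · exact Or.inr (hML.symm ▸ restrictLetters_subset L)
        · rcases mem_supportedOn.1 hw s hs M hM with h' | h'
          · exact Or.inl (subset_restrictLetters h' h)
          · exact absurd (Finset.eq_of_subset_of_card_le h (hmin M h')) hML
      · exact Or.inr ((restrictLetters_subset L).trans h)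
    have hstar : ∀ s : AugFace (coxeterSubcomplex n I), w s ≠ 0 → L ∈ s.verts →
        insert (restrictLetters I L) s.verts ∈ (coxeterSubcomplex n I).faces ∧
          ∀ M ∈ s.verts, M < restrictLetters I L ∨ M = restrictLetters I L ∨
            restrictLetters I L < M := by
      intro s hs hLs
      refine ⟨?_, fun M hM => ?_⟩
      · have hLv := s.isVertex hLs
        have hodd := isOddVertex_restrictLetters hLv.2
        refine mem_coxeterSubcomplex.2 ⟨Finset.insert_nonempty _ _, ?_, ?_⟩
        · intro M hM
          rcases Finset.mem_insert.1 hM with rfl | hM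
          · exact ⟨hLv.1.mono hodd.nonempty (restrictLetters_subset L), hodd⟩
          · exact s.isVertex hM
        · intro M hM M' hM'
          rcases Finset.mem_insert.1 hM with rfl | hM <;>
            rcases Finset.mem_insert.1 hM' with rfl | hM'
          · exact Or.inl le_rfl
          · exact (key s hs hLs _ hM').symm
          · exact key s hs hLs _ hM
          · exact s.subset_total hM hM'
      · by_cases h : M = restrictLetters I L
        · exact Or.inr (Or.inl h)
        · rcases key s hs hLs M hM with h' | h'
          · exact Or.inl (lt_of_le_of_ne h' h)
          · exact Or.inr (Or.inr (lt_of_le_of_ne h' (Ne.symm h)))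
    obtain ⟨w', hd', hww', hU'⟩ := exists_sub_mem_boundaries_of_star haL hd hw hstar
      (supportedOn_mono (fun M hM h => hLI ((show M = L from h) ▸ hM)) hb)
    have hU : w' ∈ supportedOn (coxeterSubcomplex n I) (signedSets I ∪ (B.erase L : Finset _)) := by
      refine supportedOn_mono ?_ hU'
      rintro M ⟨rfl | hM | hM, hML⟩
      · exact Or.inl (restrictLetters_mem L)
      · exact Or.inl hM
      · exact Or.inr (Finset.mem_coe.2 (Finset.mem_erase.2 ⟨hML, hM⟩))
    -- The chain changed by a boundary, so its own boundary is the same as before.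
    have hb' : boundary _ w' ∈ supportedOn (coxeterSubcomplex n I) (signedSets I) := by
      obtain ⟨c, -, hc⟩ := Submodule.mem_map.1 hww'
      have h1 := boundary_boundary_coxeter c
      rw [hc, map_sub, sub_eq_zero] at h1
      rwa [← h1]
    obtain ⟨w'', hd'', hww'', hU''⟩ := ih (B.erase L) hcard w' hd' hU hb'
    refine ⟨w'', hd'', ?_, hU''⟩
    rw [← sub_add_sub_cancel w w' w'']
    exact Submodule.add_mem _ hww' hww''

/-- Every chain whose boundary only involves subsets of `±I` is, modulo boundaries, a chain which
only involves subsets of `±I`. -/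
theorem exists_sub_mem_boundaries {d : ℤ} (w : Chains (coxeterSubcomplex n I))
    (hd : w ∈ chainsOfDegree _ d)
    (hb : boundary _ w ∈ supportedOn (coxeterSubcomplex n I) (signedSets I)) :
    ∃ w' ∈ chainsOfDegree (coxeterSubcomplex n I) d, w - w' ∈ boundaries _ d ∧
      w' ∈ supportedOn (coxeterSubcomplex n I) (signedSets I) := by
  refine exists_sub_mem_boundaries_aux _ (w.support.biUnion fun s => s.verts) rfl w hd ?_ hb
  refine mem_supportedOn.2 fun s hs v hv => Or.inr ?_
  exact Finset.mem_coe.2 (Finset.mem_biUnion.2 ⟨s, Finsupp.mem_support_iff.2 hs, hv⟩)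

/-- The cardinalities of the vertices of a face on subsets of `±I`. -/
theorem AugFace.image_card_subset (s : AugFace (coxeterSubcomplex n I))
    (hs : ∀ L ∈ s.verts, L ∈ signedSets I) :
    s.verts.image Finset.card ⊆
      (Finset.Icc 1 ((I.card + 1) / 2)).image fun i => 2 * i - 1 := by
  intro m hm
  obtain ⟨L, hL, rfl⟩ := Finset.mem_image.1 hm
  obtain ⟨⟨j, hj⟩, h2⟩ := card_odd_and_le (s.isVertex hL).1 (s.isVertex hL).2 (hs L hL)
  exact Finset.mem_image.2 ⟨j + 1, Finset.mem_Icc.2 (by omega), by omega⟩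

theorem AugFace.card_image_card (s : AugFace (coxeterSubcomplex n I)) :
    (s.verts.image Finset.card).card = s.verts.card :=
  Finset.card_image_of_injOn fun _ hL _ hL' h => s.eq_of_card_eq hL hL' h

theorem card_image_two_mul_sub_one (k : ℕ) :
    ((Finset.Icc 1 k).image fun i => 2 * i - 1).card = k := by
  rw [Finset.card_image_of_injOn, Nat.card_Icc, Nat.add_sub_cancel]
  intro a ha b hb h
  simp only [Finset.coe_Icc, Set.mem_Icc] at ha hb h
  omega

theorem AugFace.card_le (s : AugFace (coxeterSubcomplex n I))
    (hs : ∀ L ∈ s.verts, L ∈ signedSets I) : s.verts.card ≤ (I.card + 1) / 2 := by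
  rw [← s.card_image_card, ← card_image_two_mul_sub_one ((I.card + 1) / 2)]
  exact Finset.card_le_card (s.image_card_subset hs)

/-- A face on subsets of `±I` of the maximal dimension has a vertex of each odd size. -/
theorem AugFace.exists_card_eq (s : AugFace (coxeterSubcomplex n I))
    (hs : ∀ L ∈ s.verts, L ∈ signedSets I) (hk : s.verts.card = (I.card + 1) / 2) {i : ℕ}
    (hi : 1 ≤ i) (hi' : i ≤ (I.card + 1) / 2) : ∃ L ∈ s.verts, L.card = 2 * i - 1 := by
  have h := Finset.eq_of_subset_of_card_le (s.image_card_subset hs)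
    (by rw [s.card_image_card, card_image_two_mul_sub_one, hk])
  have h2 : 2 * i - 1 ∈ s.verts.image Finset.card := by
    rw [h]
    exact Finset.mem_image.2 ⟨i, Finset.mem_Icc.2 ⟨hi, hi'⟩, rfl⟩
  exact Finset.mem_image.1 h2

end Coxeter

/-! ### Words -/

section Words

variable {n : ℕ} {I : Finset ℕ}

/-- The letters of `x` for `r` odd, and the letters of `-x` for `r` even. -/
def SignedPerm.normLetter (x : SignedPerm I) (j : ℕ) : ℤ :=
  if Odd I.card then x.letter j else -x.letter j

theorem SignedPerm.vertex_false (x : SignedPerm I) (i : ℕ) :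
    x.vertex i false = (Finset.Icc 1 (2 * i - 1)).image x.normLetter := rfl

/-- Negating the word for r even makes the inequalities depend on the parity of the position j
alone: odd positions are peaks. The parity of r remains only in the sign of the last letter. -/
theorem SignedPerm.isBSnake_iff (x : SignedPerm I) :
    x.IsBSnake ↔
      (1 ≤ I.card → (Odd I.card → 0 < x.normLetter I.card) ∧
        (Even I.card → x.normLetter I.card < 0)) ∧
      ∀ j, 1 ≤ j → j < I.card → (Odd j → x.normLetter (j + 1) < x.normLetter j) ∧
        (Even j → x.normLetter j < x.normLetter (j + 1)) := by
  unfold SignedPerm.IsBSnake SignedPerm.normLetter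
  rcases Nat.even_or_odd I.card with hr | hr
  · have hr' : ¬ Odd I.card := Nat.not_odd_iff_even.2 hr
    simp only [hr, hr', if_false, neg_lt_neg_iff, Left.neg_neg_iff, false_implies, true_and,
      true_implies]
    refine and_congr_right fun _ => forall_congr' fun j => forall₂_congr fun h1 h2 => ?_
    rw [Nat.odd_sub h2.le, Nat.even_sub h2.le]
    simp [hr, hr']
  · have hr' : ¬ Even I.card := Nat.not_even_iff_odd.2 hr
    simp only [hr, hr', if_true, false_implies, and_true, true_implies]
    refine and_congr_right fun _ => forall_congr' fun j => forall₂_congr fun h1 h2 => ?_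
    rw [Nat.odd_sub h2.le, Nat.even_sub h2.le]
    simp only [hr, hr', true_iff, false_iff, Nat.not_even_iff_odd]
    exact and_comm

/-- The signed permutation with a given word. -/
def SignedPerm.ofWord (w : ℕ → ℤ) (h : ∀ j, 1 ≤ j → j ≤ I.card → (w j).natAbs ∈ I)
    (hinj : ∀ j j', 1 ≤ j → j ≤ I.card → 1 ≤ j' → j' ≤ I.card →
      (w j).natAbs = (w j').natAbs → j = j') : SignedPerm I where
  toFun i := w (I.card - (I.orderIsoOfFin rfl).symm i)
  natAbs_mem i := h _ (by omega) (by omega)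
  natAbs_injective i i' hii := by
    have := hinj _ _ (by omega) (by omega) (by omega) (by omega) hii
    exact (I.orderIsoOfFin rfl).symm.injective (Fin.ext (by omega))

theorem SignedPerm.letter_ofWord (w : ℕ → ℤ) (h : ∀ j, 1 ≤ j → j ≤ I.card → (w j).natAbs ∈ I)
    (hinj : ∀ j j', 1 ≤ j → j ≤ I.card → 1 ≤ j' → j' ≤ I.card →
      (w j).natAbs = (w j').natAbs → j = j') {j : ℕ} (h1 : 1 ≤ j) (h2 : j ≤ I.card) :
    (SignedPerm.ofWord w h hinj).letter j = w j := by
  rw [SignedPerm.letter, dif_pos ⟨h1, h2⟩]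
  simp only [SignedPerm.ofWord, OrderIso.symm_apply_apply]
  congr 1
  omega

theorem SignedPerm.ext_letter {x y : SignedPerm I}
    (h : ∀ j, 1 ≤ j → j ≤ I.card → x.letter j = y.letter j) : x = y := by
  have : x.toFun = y.toFun := by
    funext i
    have h1 := h (I.card - (I.orderIsoOfFin rfl).symm i) (by omega) (by omega)
    rw [SignedPerm.letter, SignedPerm.letter, dif_pos (by omega), dif_pos (by omega)] at h1
    have h2 : (⟨I.card - (I.card - (I.orderIsoOfFin rfl).symm i), by omega⟩ : Fin I.card) =
        (I.orderIsoOfFin rfl).symm i := Fin.ext (by simp only; omega)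
    rwa [h2, OrderIso.apply_symm_apply] at h1
  cases x; cases y
  congr

instance : Finite (SignedPerm I) := by
  let f : SignedPerm I → I → Finset.Icc (-((I.sup id : ℕ) : ℤ)) ((I.sup id : ℕ) : ℤ) :=
    fun x i =>
    ⟨x.toFun i, by
      have h : (x.toFun i).natAbs ≤ I.sup id := Finset.le_sup (f := id) (x.natAbs_mem i)
      rw [Finset.mem_Icc]
      omega⟩
  refine Finite.of_injective f fun x y h => ?_
  have : x.toFun = y.toFun := by
    funext i
    exact congrArg Subtype.val (congrFun h i)
  cases x; cases y
  congr

theorem SignedPerm.vertex_mem_signedSets (x : SignedPerm I) {i : ℕ} (hi' : 2 * i - 1 ≤ I.card)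
    (b : Bool) : x.vertex i b ∈ signedSets I := by
  intro e he
  simp only [vertex, prefixSet, Finset.mem_image, Finset.mem_Icc] at he
  obtain ⟨j, hj, rfl⟩ := he
  have h1 : ∀ u : ℕ → ℤ, (if Odd I.card then u j else -u j).natAbs = (u j).natAbs := by
    intro u; split_ifs <;> simp
  rw [h1]
  cases b
  · exact x.letter_mem (by omega) (by omega)
  · simp only [if_true]
    rw [starWord_natAbs]
    apply x.letter_mem <;> grind

/-! ### Weights -/

/-- The sum of the letters of a signed set. -/
def letterSum (L : Finset ℤ) : ℤ := ∑ e ∈ L, e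

/-- The total letter sum of a collection of signed sets. -/
def weight (s : Finset (Finset ℤ)) : ℤ := ∑ L ∈ s, letterSum L

/-- The two differences have the same nonzero size, and each letter of one is smaller than each
letter of the other. Used contrapositively, to produce an exchange. -/
theorem letterSum_lt_of_exchange {L M : Finset ℤ} (hcard : L.card = M.card) (hne : M ≠ L)
    (h : ∀ e ∈ L, e ∉ M → ∀ f ∈ M, f ∉ L → e < f) : letterSum L < letterSum M := by
  have hc : (L \ M).card = (M \ L).card := Finset.card_sdiff_comm hcard
  have hpos : (L \ M).Nonempty := by
    rw [Finset.sdiff_nonempty]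
    exact fun h' => hne (Finset.eq_of_subset_of_card_le h' hcard.ge).symm
  have h1 : letterSum L = ∑ e ∈ L ∩ M, e + ∑ e ∈ L \ M, e :=
    (Finset.sum_inter_add_sum_sdiff L M _).symm
  have h2 : letterSum M = ∑ e ∈ M ∩ L, e + ∑ e ∈ M \ L, e :=
    (Finset.sum_inter_add_sum_sdiff M L _).symm
  obtain ⟨c, hc1, hc2⟩ := (L \ M).exists_max_image id hpos
  have h3 := Finset.sum_le_card_nsmul (L \ M) (fun e => e) c hc2
  -- With c the largest letter of L \ M, integrality puts every letter of M \ L at c + 1 or more.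
  have h4 := Finset.card_nsmul_le_sum (M \ L) (fun e => e) (c + 1) fun f hf => by
    rw [Finset.mem_sdiff] at hf hc1
    exact h c hc1.1 hc1.2 f hf.1 hf.2
  have h5 : 0 < (L \ M).card := Finset.card_pos.2 hpos
  rw [← hc] at h4
  rw [h1, h2, Finset.inter_comm M L]
  simp only [nsmul_eq_mul] at h3 h4
  have h6 : ((L \ M).card : ℤ) * (c + 1) = (L \ M).card * c + (L \ M).card := by ring
  omega

theorem sum_Icc_starWord (r : ℕ) (w : ℕ → ℤ) {m : ℕ} (hm : 2 * m ≤ r) :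
    ∑ j ∈ Finset.Icc 1 (2 * m), starWord r w j = ∑ j ∈ Finset.Icc 1 (2 * m), w j := by
  induction m with
  | zero => simp
  | succ m ih =>
    have h1 : 2 * (m + 1) = 2 * m + 1 + 1 := by ring
    rw [h1, Finset.sum_Icc_succ_top (by omega), Finset.sum_Icc_succ_top (by omega),
      Finset.sum_Icc_succ_top (by omega), Finset.sum_Icc_succ_top (by omega), ih (by omega)]
    have h2 : starWord r w (2 * m + 1) = w (2 * m + 1 + 1) := by
      unfold starWord
      grind
    have h3 : starWord r w (2 * m + 1 + 1) = w (2 * m + 1) := by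
      unfold starWord
      grind
    rw [h2, h3]
    ring

theorem SignedPerm.letterSum_vertex (hI : I ⊆ Finset.Icc 1 n) (x : SignedPerm I) {i : ℕ}
    (hi : 1 ≤ i) (hi' : 2 * i - 1 ≤ I.card) (b : Bool) :
    letterSum (x.vertex i b) = ∑ j ∈ Finset.Icc 1 (2 * i - 1), if Odd I.card then
      (if b then starWord I.card x.letter else x.letter) j else
      -(if b then starWord I.card x.letter else x.letter) j := by
  have h := (x.vertex_spec hI hi hi' b).2.2
  have hinj := Finset.card_image_iff.1 (h.trans (by simp : 2 * i - 1 = (Finset.Icc 1 (2 * i - 1)).card))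
  exact Finset.sum_image hinj

/-- The star operation permutes the first 2i − 2 letters among themselves, so only position 2i − 1
matters. There a peak is replaced by the lower letter at position 2i, or, at the end of a word of
odd length, a positive letter is replaced by its negative. -/
theorem SignedPerm.IsBSnake.letterSum_vertex_lt (hI : I ⊆ Finset.Icc 1 n) {x : SignedPerm I}
    (hx : x.IsBSnake) {i : ℕ} (hi : 1 ≤ i) (hi' : 2 * i - 1 ≤ I.card) :
    letterSum (x.vertex i true) < letterSum (x.vertex i false) := by
  rw [x.letterSum_vertex hI hi hi', x.letterSum_vertex hI hi hi']
  obtain ⟨m, rfl⟩ : ∃ m, i = m + 1 := ⟨i - 1, by omega⟩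
  have h1 : 2 * (m + 1) - 1 = 2 * m + 1 := by omega
  rw [h1] at hi' ⊢
  rw [Finset.sum_Icc_succ_top (by omega), Finset.sum_Icc_succ_top (by omega)]
  have h2 := sum_Icc_starWord I.card x.letter (m := m) (by omega)
  have h3 : starWord I.card x.letter (2 * m + 1) =
      if 2 * m + 1 = I.card then -x.letter (2 * m + 1) else x.letter (2 * m + 2) := by
    unfold starWord
    grind
  obtain ⟨hx1, hx2⟩ := x.isBSnake_iff.1 hx
  have hx1 := hx1 (by omega)
  have hx2 := hx2 (2 * m + 1) (by omega)
  unfold SignedPerm.normLetter at hx1 hx2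
  rcases Nat.even_or_odd I.card with hr | hr
  · have hr' : ¬ Odd I.card := Nat.not_odd_iff_even.2 hr
    have h4 : 2 * m + 1 ≠ I.card := fun h => hr' (h ▸ ⟨m, rfl⟩)
    have h5 := (hx2 (by omega)).1 ⟨m, rfl⟩
    simp only [hr', if_false, if_true, Finset.sum_neg_distrib, h3, h4] at h5 ⊢
    simp only [Bool.false_eq_true, if_false]
    linarith
  · simp only [hr, if_true, h3] at hx1 hx2 ⊢
    simp only [Bool.false_eq_true, if_false]
    by_cases h4 : 2 * m + 1 = I.card
    · have := hx1.1 trivial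
      rw [← h4] at this
      simp only [h4, if_true] at this ⊢
      linarith
    · have := (hx2 (by omega)).1 ⟨m, rfl⟩
      simp only [h4, if_false]
      linarith

/-! ### The leading face of a cross-polytope -/

/-- The faces of the cross-polytope `□ₓ`. -/
def SignedPerm.face (hI : I ⊆ Finset.Icc 1 n) (x : SignedPerm I)
    (ε : Fin ((I.card + 1) / 2) → Bool) : AugFace (coxeterSubcomplex n I) :=
  ⟨Finset.univ.image fun i : Fin ((I.card + 1) / 2) => x.vertex (i + 1) (ε i), x.vertex_face hI ε⟩

/-- The face `F₁(x) ⊂ ⋯ ⊂ F_k(x)`. -/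
def SignedPerm.leadingFace (hI : I ⊆ Finset.Icc 1 n) (x : SignedPerm I) :
    AugFace (coxeterSubcomplex n I) := x.face hI fun _ => false

theorem SignedPerm.weight_face (hI : I ⊆ Finset.Icc 1 n) (x : SignedPerm I)
    (ε : Fin ((I.card + 1) / 2) → Bool) :
    weight (x.face hI ε).verts =
      ∑ i : Fin ((I.card + 1) / 2), letterSum (x.vertex (i + 1) (ε i)) :=
  Finset.sum_image fun _ _ _ _ h => (x.vertex_strictMono hI ε).injective h

theorem SignedPerm.IsBSnake.weight_face_lt (hI : I ⊆ Finset.Icc 1 n) {x : SignedPerm I}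
    (hx : x.IsBSnake) {ε : Fin ((I.card + 1) / 2) → Bool} (hε : ε ≠ fun _ => false) :
    weight (x.face hI ε).verts < weight (x.leadingFace hI).verts := by
  rw [SignedPerm.leadingFace, x.weight_face, x.weight_face]
  have hlt : ∀ i : Fin ((I.card + 1) / 2), ε i = true →
      letterSum (x.vertex (i + 1) (ε i)) < letterSum (x.vertex (i + 1) false) := by
    intro i h
    rw [h]
    exact hx.letterSum_vertex_lt hI (by omega) (by have := i.2; omega)
  obtain ⟨i, hi⟩ := Function.ne_iff.1 hε
  refine Finset.sum_lt_sum (fun i _ => ?_) ⟨i, Finset.mem_univ i, hlt i (by simpa using hi)⟩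
  cases h : ε i
  · exact le_rfl
  · exact h ▸ (hlt i h).le

theorem SignedPerm.crossPolytopeCycle_apply (hI : I ⊆ Finset.Icc 1 n) (x : SignedPerm I)
    (t : AugFace (coxeterSubcomplex n I)) :
    (x.crossPolytopeCycle hI).1 t =
      ∑ ε, (Finsupp.single (x.face hI ε) (∏ i, if ε i then (-1 : ℚ) else 1)) t :=
  Finsupp.finsetSum_apply _ _ _

theorem SignedPerm.exists_face_of_apply_ne_zero (hI : I ⊆ Finset.Icc 1 n) (x : SignedPerm I)
    {t : AugFace (coxeterSubcomplex n I)} (ht : (x.crossPolytopeCycle hI).1 t ≠ 0) :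
    ∃ ε, t = x.face hI ε := by
  by_contra! h
  refine ht ?_
  rw [x.crossPolytopeCycle_apply]
  exact Finset.sum_eq_zero fun ε _ => Finsupp.single_eq_of_ne (h ε)

theorem SignedPerm.IsBSnake.apply_leadingFace (hI : I ⊆ Finset.Icc 1 n) {x : SignedPerm I}
    (hx : x.IsBSnake) : (x.crossPolytopeCycle hI).1 (x.leadingFace hI) = 1 := by
  rw [x.crossPolytopeCycle_apply, Finset.sum_eq_single_of_mem (fun _ => false) (Finset.mem_univ _)]
  · rw [SignedPerm.leadingFace, Finsupp.single_eq_same]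
    simp
  · intro ε _ hε
    exact Finsupp.single_eq_of_ne fun h =>
      (hx.weight_face_lt hI hε).ne (congrArg (fun s => weight s.verts) h.symm)

theorem SignedPerm.IsBSnake.weight_le_of_apply_ne_zero (hI : I ⊆ Finset.Icc 1 n)
    {x : SignedPerm I} (hx : x.IsBSnake) {t : AugFace (coxeterSubcomplex n I)}
    (ht : (x.crossPolytopeCycle hI).1 t ≠ 0) :
    t = x.leadingFace hI ∨ weight t.verts < weight (x.leadingFace hI).verts := by
  obtain ⟨ε, rfl⟩ := x.exists_face_of_apply_ne_zero hI ht
  by_cases h : ε = fun _ => false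
  · exact Or.inl (h ▸ rfl)
  · exact Or.inr (hx.weight_face_lt hI h)

theorem SignedPerm.crossPolytopeCycle_mem_supportedOn (hI : I ⊆ Finset.Icc 1 n)
    (x : SignedPerm I) :
    (x.crossPolytopeCycle hI).1 ∈ supportedOn (coxeterSubcomplex n I) (signedSets I) := by
  refine mem_supportedOn.2 fun s hs L hL => ?_
  obtain ⟨ε, rfl⟩ := x.exists_face_of_apply_ne_zero hI hs
  obtain ⟨i, -, rfl⟩ := Finset.mem_image.1 hL
  exact x.vertex_mem_signedSets (by have := i.2; omega) _

theorem SignedPerm.mem_leadingFace (hI : I ⊆ Finset.Icc 1 n) (x : SignedPerm I) {L : Finset ℤ} :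
    L ∈ (x.leadingFace hI).verts ↔
      ∃ i, 1 ≤ i ∧ i ≤ (I.card + 1) / 2 ∧ x.vertex i false = L := by
  constructor
  · intro h
    obtain ⟨i, -, rfl⟩ := Finset.mem_image.1 h
    exact ⟨i + 1, by omega, i.2, rfl⟩
  · rintro ⟨i, h1, h2, rfl⟩
    exact Finset.mem_image.2 ⟨⟨i - 1, by omega⟩, Finset.mem_univ _, by
      simp only [Nat.sub_add_cancel h1]⟩

/-- Within a chain the size 2i − 1 singles out the i-th vertex. -/
theorem SignedPerm.vertex_eq_of_leadingFace_eq (hI : I ⊆ Finset.Icc 1 n) {x y : SignedPerm I}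
    (h : x.leadingFace hI = y.leadingFace hI) {i : ℕ} (h1 : 1 ≤ i) (h2 : i ≤ (I.card + 1) / 2) :
    x.vertex i false = y.vertex i false := by
  have hx : x.vertex i false ∈ (y.leadingFace hI).verts :=
    h ▸ (x.mem_leadingFace hI).2 ⟨i, h1, h2, rfl⟩
  have hy : y.vertex i false ∈ (y.leadingFace hI).verts := (y.mem_leadingFace hI).2 ⟨i, h1, h2, rfl⟩
  refine AugFace.eq_of_card_eq _ hx hy ?_
  rw [(x.vertex_spec hI h1 (by omega) _).2.2, (y.vertex_spec hI h1 (by omega) _).2.2]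

end Words

/-! ### Recovering a snake from its leading face. -/

section Snakes

variable {n : ℕ} {I : Finset ℕ}

theorem SignedPerm.natAbs_normLetter (x : SignedPerm I) (j : ℕ) :
    (x.normLetter j).natAbs = (x.letter j).natAbs := by
  unfold SignedPerm.normLetter
  split_ifs <;> simp

theorem SignedPerm.ext_normLetter {x y : SignedPerm I}
    (h : ∀ j, 1 ≤ j → j ≤ I.card → x.normLetter j = y.normLetter j) : x = y := by
  refine SignedPerm.ext_letter fun j h1 h2 => ?_
  have := h j h1 h2
  unfold SignedPerm.normLetter at this
  split_ifs at this
  · exact this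
  · exact neg_injective this

/-- Pigeonhole: r distinct absolute values in I exhaust I. -/
theorem exists_natAbs_eq {u : ℕ → ℤ} (h : ∀ j, 1 ≤ j → j ≤ I.card → (u j).natAbs ∈ I)
    (hinj : ∀ j j', 1 ≤ j → j ≤ I.card → 1 ≤ j' → j' ≤ I.card →
      (u j).natAbs = (u j').natAbs → j = j') {p : ℕ} (hp : p ∈ I) :
    ∃ j, 1 ≤ j ∧ j ≤ I.card ∧ (u j).natAbs = p := by
  have hsub : (Finset.Icc 1 I.card).image (fun j => (u j).natAbs) ⊆ I := by
    intro e he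
    obtain ⟨j, hj, rfl⟩ := Finset.mem_image.1 he
    exact h j (Finset.mem_Icc.1 hj).1 (Finset.mem_Icc.1 hj).2
  have hcard : ((Finset.Icc 1 I.card).image fun j => (u j).natAbs).card = I.card := by
    rw [Finset.card_image_of_injOn, Nat.card_Icc, Nat.add_sub_cancel]
    intro a ha b hb hab
    rw [Finset.mem_coe, Finset.mem_Icc] at ha hb
    exact hinj a b ha.1 ha.2 hb.1 hb.2 hab
  rw [← Finset.eq_of_subset_of_card_le hsub hcard.ge] at hp
  obtain ⟨j, hj, h⟩ := Finset.mem_image.1 hp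
  exact ⟨j, (Finset.mem_Icc.1 hj).1, (Finset.mem_Icc.1 hj).2, h⟩

theorem SignedPerm.normLetter_injective (x : SignedPerm I) (j j' : ℕ) (h1 : 1 ≤ j)
    (h2 : j ≤ I.card) (h1' : 1 ≤ j') (h2' : j' ≤ I.card)
    (h : (x.normLetter j).natAbs = (x.normLetter j').natAbs) : j = j' := by
  rw [x.natAbs_normLetter, x.natAbs_normLetter] at h
  exact x.letter_inj h1 h2 h1' h2' h

theorem SignedPerm.normLetter_mem (x : SignedPerm I) (j : ℕ) (h1 : 1 ≤ j)
    (h2 : j ≤ I.card) : (x.normLetter j).natAbs ∈ I := by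
  rw [x.natAbs_normLetter]
  exact x.letter_mem h1 h2

/-- A snake is determined by its leading face. -/
theorem SignedPerm.IsBSnake.eq_of_leadingFace_eq (hI : I ⊆ Finset.Icc 1 n) {x y : SignedPerm I}
    (hx : x.IsBSnake) (hy : y.IsBSnake) (h : x.leadingFace hI = y.leadingFace hI) : x = y := by
  obtain ⟨hx1, hx2⟩ := x.isBSnake_iff.1 hx
  obtain ⟨hy1, hy2⟩ := y.isBSnake_iff.1 hy
  have hmem : ∀ m, 2 * m + 1 ≤ I.card → ∀ j, 1 ≤ j → j ≤ 2 * m + 1 →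
      ∃ j', 1 ≤ j' ∧ j' ≤ 2 * m + 1 ∧ y.normLetter j' = x.normLetter j := by
    intro m hm j h1 h2
    have hv := SignedPerm.vertex_eq_of_leadingFace_eq hI h (i := m + 1) (by omega) (by omega)
    rw [x.vertex_false, y.vertex_false] at hv
    have h3 : x.normLetter j ∈ (Finset.Icc 1 (2 * (m + 1) - 1)).image y.normLetter :=
      hv ▸ Finset.mem_image_of_mem _ (Finset.mem_Icc.2 (by omega))
    obtain ⟨j', hj', h4⟩ := Finset.mem_image.1 h3
    rw [Finset.mem_Icc] at hj'
    exact ⟨j', hj'.1, by omega, h4⟩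
  have key : ∀ m, 2 * m + 1 ≤ I.card → ∀ j, 1 ≤ j → j ≤ 2 * m + 1 →
      x.normLetter j = y.normLetter j := by
    intro m
    induction m with
    | zero =>
      intro hm j h1 h2
      obtain ⟨j', h3, h4, h5⟩ := hmem 0 hm j h1 h2
      obtain rfl : j = 1 := by omega
      obtain rfl : j' = 1 := by omega
      exact h5.symm
    | succ m ih =>
      intro hm j h1 h2
      have ih := ih (by omega)
      by_cases hj : j ≤ 2 * m + 1
      · exact ih j h1 hj
      have hnew : ∀ i, 2 * m + 2 ≤ i → i ≤ 2 * m + 3 →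
          x.normLetter i = y.normLetter (2 * m + 2) ∨ x.normLetter i = y.normLetter (2 * m + 3) := by
        intro i hi hi'
        obtain ⟨j', h3, h4, h5⟩ := hmem (m + 1) hm i (by omega) (by omega)
        by_cases hj' : j' ≤ 2 * m + 1
        · rw [← ih j' h3 hj'] at h5
          have := x.normLetter_injective j' i h3 (by omega) (by omega) (by omega)
            (congrArg Int.natAbs h5)
          omega
        · rcases (by omega : j' = 2 * m + 2 ∨ j' = 2 * m + 3) with rfl | rfl
          exacts [Or.inl h5.symm, Or.inr h5.symm]
      -- Consecutive prefixes determine the pair of new letters as a set; both words list it in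
      -- increasing order.
      have e1 := (hx2 (2 * m + 2) (by omega) (by omega)).2 ⟨m + 1, by ring⟩
      have e2 := (hy2 (2 * m + 2) (by omega) (by omega)).2 ⟨m + 1, by ring⟩
      have e3 := hnew (2 * m + 2) (by omega) (by omega)
      have e4 := hnew (2 * m + 3) (by omega) (by omega)
      change x.normLetter (2 * m + 2) < x.normLetter (2 * m + 3) at e1
      change y.normLetter (2 * m + 2) < y.normLetter (2 * m + 3) at e2
      rcases (by omega : j = 2 * m + 2 ∨ j = 2 * m + 3) with rfl | rfl <;> omega
  refine SignedPerm.ext_normLetter fun j h1 h2 => ?_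
  by_cases hj : j < I.card ∨ Odd I.card
  · refine key ((j - 1) / 2 + (j - 1) % 2) ?_ j h1 (by omega)
    rcases hj with hj | ⟨q, hq⟩
    · omega
    · omega
  · push Not at hj
    obtain ⟨hj, hr⟩ := hj
    obtain rfl : j = I.card := by omega
    obtain ⟨q, hq⟩ := Nat.not_odd_iff_even.1 hr
    -- For r even the last letter lies in no prefix. Its absolute value is the only one left over,
    -- and its normalized sign is negative in both snakes.
    obtain ⟨j', h3, h4, h5⟩ := exists_natAbs_eq y.normLetter_mem y.normLetter_injective
      (x.normLetter_mem I.card h1 le_rfl)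
    by_cases hj' : j' < I.card
    · rw [← key (q - 1) (by omega) j' h3 (by omega)] at h5
      have := x.normLetter_injective j' I.card h3 h4 h1 le_rfl h5
      omega
    · obtain rfl : j' = I.card := by omega
      have e1 := (hx1 h1).2 ⟨q, hq⟩
      have e2 := (hy1 h1).2 ⟨q, hq⟩
      omega

end Snakes

/-! ### Faces of maximal weight in a top cycle. -/

section Leading

variable {n : ℕ} {I : Finset ℕ}

/-- A face of maximal weight in the support of a top-dimensional cycle on subsets of `±I`: in each
of its vertices a letter can be exchanged for a smaller one. -/
theorem exists_exchange {z : Chains (coxeterSubcomplex n I)} (hz : boundary _ z = 0)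
    (hsupp : z ∈ supportedOn (coxeterSubcomplex n I) (signedSets I))
    {s : AugFace (coxeterSubcomplex n I)} (hs : z s ≠ 0)
    (hmax : ∀ s', z s' ≠ 0 → weight s'.verts ≤ weight s.verts)
    {F : ℕ → Finset ℤ} (hF0 : F 0 = ∅)
    (hF : ∀ i, 1 ≤ i → i ≤ (I.card + 1) / 2 → F i ∈ s.verts ∧ (F i).card = 2 * i - 1)
    {i : ℕ} (h1 : 1 ≤ i) (hi : i ≤ (I.card + 1) / 2) :
    ∃ e ∈ F i, e ∉ F (i - 1) ∧ ∃ f, f ∉ F i ∧ f < e ∧ f.natAbs ∈ I ∧ -f ∉ F (i - 1) ∧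
      (i < (I.card + 1) / 2 → f ∈ F (i + 1)) := by
  obtain ⟨s', hs', hne, M, hM, heq⟩ := exists_ne_of_boundary_eq_zero hz hs (hF i h1 hi).1
  have hI' : ∀ L ∈ s'.verts, L ∈ signedSets I := fun L hL => mem_supportedOn.1 hsupp s' hs' L hL
  have hmem : ∀ j, 1 ≤ j → j ≤ (I.card + 1) / 2 → j ≠ i → F j ∈ s'.verts ∧ F j ≠ M := by
    intro j hj hj' hji
    have h : F j ∈ s.verts.erase (F i) := by
      refine Finset.mem_erase.2 ⟨fun h => hji ?_, (hF j hj hj').1⟩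
      have := congrArg Finset.card h
      rw [(hF j hj hj').2, (hF i h1 hi).2] at this
      omega
    rw [← heq] at h
    exact ⟨Finset.mem_of_mem_erase h, Finset.ne_of_mem_erase h⟩
  -- Every other odd size up to r is already taken by some F_j in the same chain.
  have hMcard : M.card = 2 * i - 1 := by
    obtain ⟨⟨j, hj⟩, h2⟩ := card_odd_and_le (s'.isVertex hM).1 (s'.isVertex hM).2 (hI' M hM)
    by_contra hcon
    have h3 := hmem (j + 1) (by omega) (by omega) (by omega)
    refine h3.2 (s'.eq_of_card_eq h3.1 hM ?_)
    rw [(hF (j + 1) (by omega) (by omega)).2]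
    omega
  have hMF : M ≠ F i := by
    rintro rfl
    refine hne (AugFace.ext ?_)
    rw [← Finset.insert_erase hM, heq, Finset.insert_erase (hF i h1 hi).1]
  have hle : letterSum M ≤ letterSum (F i) := by
    have h := hmax s' hs'
    rw [weight, weight, ← Finset.add_sum_erase _ _ hM, heq,
      ← Finset.add_sum_erase _ _ (hF i h1 hi).1] at h
    linarith
  have hsub : F (i - 1) ⊆ M := by
    rcases (by omega : i = 1 ∨ 1 < i) with rfl | h
    · simp [hF0]
    · have h3 := hmem (i - 1) (by omega) (by omega) (by omega)
      rcases s'.subset_total h3.1 hM with h4 | h4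
      · exact h4
      · have := Finset.card_le_card h4
        rw [(hF (i - 1) (by omega) (by omega)).2] at this
        omega
  -- Without such a pair every letter gained would exceed every letter lost, contradicting the
  -- maximal weight of s.
  obtain ⟨e, he, heM, f, hf, hfF, hfe⟩ : ∃ e ∈ F i, e ∉ M ∧ ∃ f ∈ M, f ∉ F i ∧ f ≤ e := by
    by_contra! hcon
    exact absurd (letterSum_lt_of_exchange ((hF i h1 hi).2.trans hMcard.symm) hMF hcon) hle.not_gt
  refine ⟨e, he, fun h => heM (hsub h), f, hfF, lt_of_le_of_ne hfe fun h => hfF (h ▸ he),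
    hI' M hM f hf, fun h => (s'.isVertex hM).1.2.2 f hf (hsub h), fun h => ?_⟩
  have h3 := hmem (i + 1) (by omega) (by omega) (by omega)
  rcases s'.subset_total h3.1 hM with h4 | h4
  · have := Finset.card_le_card h4
    rw [(hF (i + 1) (by omega) (by omega)).2] at this
    omega
  · exact h4 hf

theorem exists_pair_of_card {L : Finset ℤ} (h : L.card = 2) : ∃ a b, a < b ∧ L = {a, b} := by
  obtain ⟨a, b, hab, rfl⟩ := Finset.card_eq_two.1 h
  rcases lt_or_gt_of_ne hab with h | h
  · exact ⟨a, b, h, rfl⟩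
  · exact ⟨b, a, h, Finset.pair_comm a b⟩

/-- The word with prefixes `F₁ ⊂ F₂ ⊂ ⋯`, in which the letters at the positions `2i` and `2i + 1`
increase. -/
theorem exists_word {F : ℕ → Finset ℤ} {k : ℕ} (hF0 : F 0 = ∅)
    (hF : ∀ i, 1 ≤ i → i ≤ k → (F i).card = 2 * i - 1)
    (hmono : ∀ i, 1 ≤ i → i ≤ k → F (i - 1) ⊆ F i) :
    ∃ u : ℕ → ℤ, (∀ i, i ≤ k → (Finset.Icc 1 (2 * i - 1)).image u = F i) ∧
      (∀ i, 1 ≤ i → i < k → u (2 * i) < u (2 * i + 1)) ∧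
      ∀ i, i < k → (∀ e ∈ F (i + 1), e ∉ F i → e ≤ u (2 * i + 1)) ∧
        (1 ≤ i → ∀ e ∈ F (i + 1), e ∉ F i → u (2 * i) ≤ e) := by
  -- Each step adds two letters, except the first, which adds one. There both names denote the same
  -- letter, and the superfluous position 0 of the word is never read.
  have hex : ∀ i, ∃ a b : ℤ, i < k → F (i + 1) \ F i = {a, b} ∧ a ≤ b ∧ (1 ≤ i → a < b) ∧
      (i = 0 → a = b) := by
    intro i
    by_cases hi : i < k
    · have hc := Finset.card_sdiff_of_subset (hmono (i + 1) (by omega) hi)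
      rw [Nat.add_sub_cancel, hF (i + 1) (by omega) hi] at hc
      rcases Nat.eq_zero_or_pos i with rfl | hpos
      · rw [hF0, Finset.card_empty] at hc
        obtain ⟨a, ha⟩ := Finset.card_eq_one.1 hc
        refine ⟨a, a, fun _ => ⟨?_, le_rfl, by omega, fun _ => rfl⟩⟩
        rw [hF0, ha]
        simp
      · rw [hF i hpos hi.le] at hc
        obtain ⟨a, b, hab, h⟩ := exists_pair_of_card (hc.trans (by omega))
        exact ⟨a, b, fun _ => ⟨h, hab.le, fun _ => hab, by omega⟩⟩
    · exact ⟨0, 0, fun h => absurd h hi⟩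
  choose lo hi hlh using hex
  let u : ℕ → ℤ := fun j => if Even j then lo (j / 2) else hi (j / 2)
  have hu0 : ∀ i, u (2 * i) = lo i := fun i => by simp [u]
  have hu1 : ∀ i, u (2 * i + 1) = hi i := fun i => by
    have h1 : ¬ Even (2 * i + 1) := by simp
    have h2 : (2 * i + 1) / 2 = i := by omega
    simp only [u, if_neg h1, h2]
  refine ⟨u, fun i => ?_, fun i h1 h2 => ?_, fun i h => ⟨fun e he he' => ?_, fun _ e he he' => ?_⟩⟩
  · induction i with
    | zero => simp [hF0]
    | succ i ih =>
      intro hik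
      have hF' : F (i + 1) = F i ∪ {lo i, hi i} := by
        rw [← (hlh i hik).1, 
          Finset.union_sdiff_of_subset (by simpa using hmono (i + 1) (by omega) hik)]
      rcases Nat.eq_zero_or_pos i with rfl | hpos
      · rw [hF', hF0, (hlh 0 hik).2.2.2 rfl, ← hu1]
        simp
      · have h2 : Finset.Icc 1 (2 * (i + 1) - 1) =
            insert (2 * i + 1) (insert (2 * i) (Finset.Icc 1 (2 * i - 1))) := by
          ext j
          simp only [Finset.mem_Icc, Finset.mem_insert]
          omega
        rw [h2, Finset.image_insert, Finset.image_insert, ih (by omega), hF', hu0, hu1]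
        ext e
        simp only [Finset.mem_insert, Finset.mem_union, Finset.mem_singleton]
        tauto
  · rw [hu0, hu1]
    exact (hlh i h2).2.2.1 h1
  · have : e ∈ F (i + 1) \ F i := Finset.mem_sdiff.2 ⟨he, he'⟩
    rw [(hlh i h).1, Finset.mem_insert, Finset.mem_singleton] at this
    rw [hu1]
    rcases this with rfl | rfl
    exacts [(hlh i h).2.1, le_rfl]
  · have : e ∈ F (i + 1) \ F i := Finset.mem_sdiff.2 ⟨he, he'⟩
    rw [(hlh i h).1, Finset.mem_insert, Finset.mem_singleton] at this
    rw [hu0]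
    rcases this with rfl | rfl
    exacts [le_rfl, (hlh i h).2.1]

/-- A collection of signed sets admitting exchanges as in `exists_exchange` is the leading face of
a snake. -/
theorem exists_snake (hI : I ⊆ Finset.Icc 1 n) {F : ℕ → Finset ℤ} (hF0 : F 0 = ∅)
    (hF : ∀ i, 1 ≤ i → i ≤ (I.card + 1) / 2 →
      (F i).card = 2 * i - 1 ∧ IsVertex n (F i) ∧ F i ∈ signedSets I)
    (hmono : ∀ i, 1 ≤ i → i ≤ (I.card + 1) / 2 → F (i - 1) ⊆ F i)
    (hex : ∀ i, 1 ≤ i → i ≤ (I.card + 1) / 2 →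
      ∃ e ∈ F i, e ∉ F (i - 1) ∧ ∃ f, f ∉ F i ∧ f < e ∧ f.natAbs ∈ I ∧ -f ∉ F (i - 1) ∧
      (i < (I.card + 1) / 2 → f ∈ F (i + 1))) :
    ∃ x : SignedPerm I, x.IsBSnake ∧
      ∀ i, 1 ≤ i → i ≤ (I.card + 1) / 2 → x.vertex i false = F i := by
  obtain ⟨u', hu', hlt', hle'⟩ := exists_word hF0 (fun i h1 h2 => (hF i h1 h2).1) hmono
  set k := (I.card + 1) / 2 with hk
  -- For r even F_k misses one absolute value of I. The last letter is its negative, as the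
  -- normalized form of a snake requires; in the other cases m is a dummy.
  have hm : ∃ m : ℤ, 1 ≤ I.card → Even I.card →
      m < 0 ∧ m.natAbs ∈ I ∧ ∀ e ∈ F k, e.natAbs ≠ m.natAbs := by
    by_cases h : 1 ≤ I.card ∧ Even I.card
    · obtain ⟨h1, q, hq⟩ := h
      have hlt : ((F k).image Int.natAbs).card < I.card := by
        refine Finset.card_image_le.trans_lt ?_
        rw [(hF k (by omega) le_rfl).1]
        omega
      obtain ⟨p, hp, hp'⟩ := Finset.exists_mem_notMem_of_card_lt_card hlt
      have hp0 := Finset.mem_Icc.1 (hI hp)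
      refine ⟨-(p : ℤ), fun _ _ => ⟨by omega, by simpa using hp, fun e he h => hp' ?_⟩⟩
      exact Finset.mem_image.2 ⟨e, he, by simpa using h⟩
    · exact ⟨0, fun h1 h2 => absurd ⟨h1, h2⟩ h⟩
  obtain ⟨m, hm⟩ := hm
  let u : ℕ → ℤ := fun j => if j ≤ 2 * k - 1 then u' j else m
  have huu : ∀ j, j ≤ 2 * k - 1 → u j = u' j := fun j h => if_pos h
  have hum : ∀ j, 2 * k - 1 < j → u j = m := fun j h => if_neg (by omega)
  have hu : ∀ i, i ≤ k → (Finset.Icc 1 (2 * i - 1)).image u = F i := by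
    intro i hi
    rw [← hu' i hi]
    refine Finset.image_congr fun j hj => huu j ?_
    rw [Finset.mem_coe, Finset.mem_Icc] at hj
    omega
  have hmem : ∀ j, 1 ≤ j → j ≤ 2 * k - 1 → u j ∈ F k := by
    intro j h1 h2
    rw [← hu k le_rfl]
    exact Finset.mem_image_of_mem _ (Finset.mem_Icc.2 ⟨h1, h2⟩)
  have hlast : ∀ j, j ≤ I.card → 2 * k - 1 < j → j = I.card ∧ 1 ≤ I.card ∧ Even I.card := by
    intro j h1 h2
    exact ⟨by omega, by omega, Nat.even_iff.2 (by omega)⟩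
  have huI : ∀ j, 1 ≤ j → j ≤ I.card → (u j).natAbs ∈ I := by
    intro j h1 h2
    by_cases h : j ≤ 2 * k - 1
    · exact (hF k (by omega) le_rfl).2.2 _ (hmem j h1 h)
    · obtain ⟨-, h3, h4⟩ := hlast j h2 (by omega)
      rw [hum j (by omega)]
      exact (hm h3 h4).2.1
  have hinj : ∀ j j', 1 ≤ j → j ≤ I.card → 1 ≤ j' → j' ≤ I.card →
      (u j).natAbs = (u j').natAbs → j = j' := by
    intro j j' h1 h2 h1' h2' h
    by_cases hj : j ≤ 2 * k - 1 <;> by_cases hj' : j' ≤ 2 * k - 1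
    · have h3 := (hF k (by omega) le_rfl).2.1.injOn_natAbs (hmem j h1 hj) (hmem j' h1' hj') h
      have h4 : ((Finset.Icc 1 (2 * k - 1)).image u).card = (Finset.Icc 1 (2 * k - 1)).card := by
        rw [hu k le_rfl, (hF k (by omega) le_rfl).1]
        simp
      exact Finset.card_image_iff.1 h4 (Finset.mem_coe.2 (Finset.mem_Icc.2 ⟨h1, hj⟩))
        (Finset.mem_coe.2 (Finset.mem_Icc.2 ⟨h1', hj'⟩)) h3
    · obtain ⟨-, h3, h4⟩ := hlast j' h2' (by omega)
      rw [hum j' (by omega)] at h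
      exact absurd h ((hm h3 h4).2.2 _ (hmem j h1 hj))
    · obtain ⟨-, h3, h4⟩ := hlast j h2 (by omega)
      rw [hum j (by omega)] at h
      exact absurd h.symm ((hm h3 h4).2.2 _ (hmem j' h1' hj'))
    · rw [(hlast j h2 (by omega)).1, (hlast j' h2' (by omega)).1]
  have hw : ∀ j, (if Odd I.card then u j else -u j).natAbs = (u j).natAbs := by
    intro j; split_ifs <;> simp
  let x : SignedPerm I := SignedPerm.ofWord (fun j => if Odd I.card then u j else -u j)
    (fun j h1 h2 => by rw [hw]; exact huI j h1 h2)
    (fun j j' h1 h2 h3 h4 h => hinj j j' h1 h2 h3 h4 (by rwa [hw, hw] at h))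
  have hx : ∀ j, 1 ≤ j → j ≤ I.card → x.normLetter j = u j := by
    intro j h1 h2
    rw [SignedPerm.normLetter, SignedPerm.letter_ofWord _ _ _ h1 h2]
    split_ifs <;> simp
  have hcase : ∀ f : ℤ, f.natAbs ∈ I → f ∉ F k → -f ∉ F k →
      1 ≤ I.card ∧ Even I.card ∧ f.natAbs = m.natAbs := by
    intro f hf h1 h2
    obtain ⟨j, h3, h4, h5⟩ := exists_natAbs_eq huI hinj hf
    by_cases h : j ≤ 2 * k - 1
    · have := hmem j h3 h
      rcases Int.natAbs_eq_natAbs_iff.1 h5 with h6 | h6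
      · exact absurd (h6 ▸ this) h1
      · exact absurd (h6 ▸ this) h2
    · obtain ⟨-, h6, h7⟩ := hlast j h4 (by omega)
      rw [hum j (by omega)] at h5
      exact ⟨h6, h7, h5.symm⟩
  have hend : 1 ≤ I.card → (Odd I.card → 0 < u' (2 * k - 1)) ∧
      (Even I.card → m < u' (2 * k - 1)) := by
    intro h1
    obtain ⟨e, he, he', f, hf, hfe, hfI, hfF, -⟩ := hex k (by omega) le_rfl
    obtain ⟨q, hq⟩ : ∃ q, k = q + 1 := ⟨k - 1, by omega⟩
    rw [hq, Nat.add_sub_cancel] at he' hfF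
    have h2 : 2 * k - 1 = 2 * q + 1 := by omega
    have h3 := (hle' q (by omega)).1
    rw [← hq] at h3
    rw [h2]
    have h4 := h3 e he he'
    -- Either −f is a letter added in F_k, and then f < u_{2k−1} and −f ≤ u_{2k−1} force u_{2k−1} >
    -- 0; or f is ± the missing letter, so r is even and m ≤ f < u_{2k−1}.
    by_cases hf' : -f ∈ F k
    · have h5 := h3 _ hf' hfF
      exact ⟨fun _ => by omega, fun h => by have := (hm h1 h).1; omega⟩
    · obtain ⟨-, h5, h6⟩ := hcase f hfI hf hf'
      refine ⟨fun h => absurd h5 (Nat.not_even_iff_odd.2 h), fun _ => ?_⟩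
      have := (hm h1 h5).1
      omega
  refine ⟨x, x.isBSnake_iff.2 ⟨fun h1 => ?_, fun j h1 h2 => ?_⟩, fun i h1 h2 => ?_⟩
  · rw [hx _ h1 le_rfl]
    refine ⟨fun h => ?_, fun h => ?_⟩
    · have h3 : I.card = 2 * k - 1 := by have := Nat.odd_iff.1 h; omega
      rw [h3, huu _ le_rfl]
      exact (hend h1).1 h
    · rw [hum _ (by have := Nat.even_iff.1 h; omega)]
      exact (hm h1 h).1
  · rw [hx j h1 h2.le, hx (j + 1) (by omega) h2]
    refine ⟨?_, ?_⟩
    · rintro ⟨i, rfl⟩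
      rw [huu (2 * i + 1) (by omega)]
      by_cases hi : i + 1 < k
      -- The descent after an odd position: the exchange pair satisfies f < e, where e is at most
      -- the larger letter of its own pair and f is at least the smaller letter of the next pair.
      · obtain ⟨e, he, he', f, hf, hfe, -, -, hf'⟩ := hex (i + 1) (by omega) hi.le
        rw [huu _ (by omega)]
        exact ((hle' (i + 1) hi).2 (by omega) f (hf' hi) hf).trans_lt
          (hfe.trans_le ((hle' i (by omega)).1 e he he'))
      · have h3 : 2 * i + 1 = 2 * k - 1 := by omega
        rw [hum _ (by omega), h3]
        exact (hend (by omega)).2 (Nat.even_iff.2 (by omega))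
    · intro hj
      obtain ⟨i, rfl⟩ := hj.two_dvd
      rw [huu _ (by omega), huu _ (by omega)]
      exact hlt' i (by omega) (by omega)
  · rw [x.vertex_false, ← hu i h2]
    refine Finset.image_congr fun j hj => hx j ?_ ?_ <;>
    · rw [Finset.mem_coe, Finset.mem_Icc] at hj
      omega

/-- A nonzero top-dimensional cycle on subsets of `±I` does not vanish on the leading face of some
snake. -/
theorem exists_snake_apply_ne_zero (hI : I ⊆ Finset.Icc 1 n)
    {z : Chains (coxeterSubcomplex n I)} (hz : boundary _ z = 0)
    (hd : z ∈ chainsOfDegree _ (((I.card : ℤ) - 1) / 2))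
    (hsupp : z ∈ supportedOn (coxeterSubcomplex n I) (signedSets I)) (hne : z ≠ 0) :
    ∃ x : SignedPerm I, x.IsBSnake ∧ z (x.leadingFace hI) ≠ 0 := by
  obtain ⟨s, hs, hmax⟩ := z.support.exists_max_image (fun s => weight s.verts)
    (Finsupp.support_nonempty_iff.2 hne)
  have hs := Finsupp.mem_support_iff.1 hs
  have hmax : ∀ s', z s' ≠ 0 → weight s'.verts ≤ weight s.verts :=
    fun s' h => hmax s' (Finsupp.mem_support_iff.2 h)
  have hsI := mem_supportedOn.1 hsupp s hs
  have hcard : s.verts.card = (I.card + 1) / 2 := by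
    have := mem_chainsOfDegree.1 hd s hs
    omega
  -- A top face has one vertex of each odd size, so it can be indexed by size; the empty set at
  -- index 0 lets the first step be treated like the others.
  have hex : ∀ i, ∃ L : Finset ℤ, (1 ≤ i → i ≤ (I.card + 1) / 2 →
      L ∈ s.verts ∧ L.card = 2 * i - 1) ∧ (i = 0 → L = ∅) := by
    intro i
    by_cases h : 1 ≤ i ∧ i ≤ (I.card + 1) / 2
    · obtain ⟨L, h1, h2⟩ := s.exists_card_eq hsI hcard h.1 h.2
      exact ⟨L, fun _ _ => ⟨h1, h2⟩, by omega⟩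
    · exact ⟨∅, fun h1 h2 => absurd ⟨h1, h2⟩ h, fun _ => rfl⟩
  choose F hF hF0 using hex
  have hmono : ∀ i, 1 ≤ i → i ≤ (I.card + 1) / 2 → F (i - 1) ⊆ F i := by
    intro i h1 h2
    rcases (by omega : i = 1 ∨ 1 < i) with rfl | h
    · simp [hF0]
    · have h3 := hF (i - 1) (by omega) (by omega)
      have h4 := hF i h1 h2
      rcases s.subset_total h3.1 h4.1 with h5 | h5
      · exact h5
      · have := Finset.card_le_card h5
        omega
  obtain ⟨x, hx, hxF⟩ := exists_snake hI (hF0 0 rfl)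
    (fun i h1 h2 => ⟨(hF i h1 h2).2, (s.isVertex (hF i h1 h2).1).1, hsI _ (hF i h1 h2).1⟩) hmono
    (fun i h1 h2 => exists_exchange hz hsupp hs hmax (hF0 0 rfl) hF h1 h2)
  refine ⟨x, hx, ?_⟩
  have hface : x.leadingFace hI = s := by
    refine AugFace.ext (Finset.eq_of_subset_of_card_le ?_ ?_)
    · intro L hL
      obtain ⟨i, h1, h2, rfl⟩ := (x.mem_leadingFace hI).1 hL
      rw [hxF i h1 h2]
      exact (hF i h1 h2).1
    · rw [hcard]
      refine le_of_eq ?_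
      change _ = (Finset.univ.image _).card
      rw [Finset.card_image_of_injective _ (x.vertex_strictMono hI fun _ => false).injective,
        Finset.card_univ, Fintype.card_fin]
  rwa [hface]

end Leading

/-! ### Leading coefficients, independence and spanning. -/

section Basis

variable {n : ℕ} {I : Finset ℕ}

/-- A boundary of top degree on subsets of `±I` vanishes. -/
theorem eq_zero_of_mem_boundaries {z : Chains (coxeterSubcomplex n I)}
    (hz : z ∈ boundaries (coxeterSubcomplex n I) (((I.card : ℤ) - 1) / 2))
    (hsupp : z ∈ supportedOn (coxeterSubcomplex n I) (signedSets I)) : z = 0 := by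
  obtain ⟨w, hw, rfl⟩ := Submodule.mem_map.1 hz
  obtain ⟨w', hd', hww', hw'⟩ := exists_sub_mem_boundaries w hw hsupp
  -- A face of w' would have k + 1 vertices, one more than there are odd sizes up to r.
  have h0 : w' = 0 := by
    ext s
    by_contra h
    have h1 := s.card_le (mem_supportedOn.1 hw' s h)
    have h2 := mem_chainsOfDegree.1 hd' s h
    omega
  obtain ⟨c, -, hc⟩ := Submodule.mem_map.1 hww'
  rw [h0, sub_zero] at hc
  rw [← hc, boundary_boundary_coxeter]

/-- The combination of the cycles `□ₓ` of snakes `x` with given coefficients. -/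
def snakeCombination (hI : I ⊆ Finset.Icc 1 n) [Fintype {x : SignedPerm I // x.IsBSnake}] :
    ({x : SignedPerm I // x.IsBSnake} → ℚ) →ₗ[ℚ]
      cycles (coxeterSubcomplex n I) (((I.card : ℤ) - 1) / 2) :=
  Fintype.linearCombination ℚ fun x => x.1.crossPolytopeCycle hI

/-- The coefficients of a cycle at the leading faces of the snakes. -/
def leadingCoefficients (hI : I ⊆ Finset.Icc 1 n) :
    cycles (coxeterSubcomplex n I) (((I.card : ℤ) - 1) / 2) →ₗ[ℚ]
      ({x : SignedPerm I // x.IsBSnake} → ℚ) :=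
  LinearMap.pi fun x => Finsupp.lapply (x.1.leadingFace hI) ∘ₗ Submodule.subtype _

variable [Fintype {x : SignedPerm I // x.IsBSnake}]

theorem leadingCoefficients_snakeCombination (hI : I ⊆ Finset.Icc 1 n)
    (g : {x : SignedPerm I // x.IsBSnake} → ℚ) (y : {x : SignedPerm I // x.IsBSnake}) :
    leadingCoefficients hI (snakeCombination hI g) y =
      ∑ x, g x * (x.1.crossPolytopeCycle hI).1 (y.1.leadingFace hI) := by
  rw [snakeCombination, Fintype.linearCombination_apply, map_sum, Finset.sum_apply]
  refine Finset.sum_congr rfl fun x _ => ?_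
  rw [map_smul]
  rfl

/-- Unitriangularity: among the snakes with nonzero coefficient choose y with leading face of
maximal weight. No other cycle in the combination meets that face, so its coefficient there is that
of y. -/
theorem leadingCoefficients_comp_injective (hI : I ⊆ Finset.Icc 1 n) :
    Function.Injective (leadingCoefficients hI ∘ₗ snakeCombination hI) := by
  classical
  rw [injective_iff_map_eq_zero]
  intro g hg
  by_contra hne
  have hS : (Finset.univ.filter fun x => g x ≠ 0).Nonempty := by
    obtain ⟨x, hx⟩ := Function.ne_iff.1 hne
    exact ⟨x, Finset.mem_filter.2 ⟨Finset.mem_univ _, hx⟩⟩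
  obtain ⟨y, hy, hmax⟩ := Finset.exists_max_image _
    (fun x : {x : SignedPerm I // x.IsBSnake} => weight (x.1.leadingFace hI).verts) hS
  have hy := (Finset.mem_filter.1 hy).2
  have h := leadingCoefficients_snakeCombination hI g y
  rw [Finset.sum_eq_single_of_mem y (Finset.mem_univ y), y.2.apply_leadingFace, mul_one] at h
  · exact hy (h.symm.trans (congrFun hg y))
  · intro x _ hxy
    by_contra hcon
    have hgx := left_ne_zero_of_mul hcon
    rcases x.2.weight_le_of_apply_ne_zero hI (right_ne_zero_of_mul hcon) with h1 | h1
    · exact hxy (Subtype.ext (y.2.eq_of_leadingFace_eq hI x.2 h1).symm)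
    · exact h1.not_ge (hmax x (Finset.mem_filter.2 ⟨Finset.mem_univ _, hgx⟩))

theorem snakeCombination_mem_supportedOn (hI : I ⊆ Finset.Icc 1 n)
    (g : {x : SignedPerm I // x.IsBSnake} → ℚ) :
    (snakeCombination hI g).1 ∈ supportedOn (coxeterSubcomplex n I) (signedSets I) := by
  rw [snakeCombination, Fintype.linearCombination_apply, Submodule.coe_sum]
  exact Submodule.sum_mem _ fun x _ =>
    Submodule.smul_mem _ _ (x.1.crossPolytopeCycle_mem_supportedOn hI)

/-- Every cycle on subsets of `±I` is a combination of the cycles of snakes. -/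
theorem exists_snakeCombination_eq (hI : I ⊆ Finset.Icc 1 n)
    (z : cycles (coxeterSubcomplex n I) (((I.card : ℤ) - 1) / 2))
    (hz : z.1 ∈ supportedOn (coxeterSubcomplex n I) (signedSets I)) :
    ∃ g, snakeCombination hI g = z := by
  -- An injective endomorphism of a finite-dimensional space is onto, so some combination has the
  -- leading coefficients of z. The difference then vanishes at every leading face of a snake.
  obtain ⟨g, hg⟩ := LinearMap.surjective_of_injective (leadingCoefficients_comp_injective hI)
    (leadingCoefficients hI z)
  refine ⟨g, ?_⟩
  by_contra hne
  obtain ⟨x, hx, hx'⟩ := exists_snake_apply_ne_zero hI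
    (z := (z - snakeCombination hI g).1) (z - snakeCombination hI g).2.2
    (z - snakeCombination hI g).2.1
    (Submodule.sub_mem _ hz (snakeCombination_mem_supportedOn hI g))
    (fun h => hne (sub_eq_zero.1 (Subtype.ext h)).symm)
  refine hx' ?_
  have h1 : leadingCoefficients hI (z - snakeCombination hI g) ⟨x, hx⟩ = 0 := by
    rw [map_sub, ← hg]
    exact sub_self _
  exact h1

theorem sum_smul_crossPolytopeClass (hI : I ⊆ Finset.Icc 1 n)
    (g : {x : SignedPerm I // x.IsBSnake} → ℚ) :
    ∑ x, g x • x.1.crossPolytopeClass hI = Submodule.Quotient.mk (snakeCombination hI g) := by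
  rw [snakeCombination, Fintype.linearCombination_apply, ← Submodule.mkQ_apply, map_sum]
  rfl

/-- A combination that is a boundary is already zero as a chain, since it is a top-degree chain on
subsets of ±I. -/
theorem linearIndependent_crossPolytopeClass (hI : I ⊆ Finset.Icc 1 n) :
    LinearIndependent ℚ fun x : {x : SignedPerm I // x.IsBSnake} =>
      x.1.crossPolytopeClass hI := by
  rw [Fintype.linearIndependent_iff]
  intro g hg
  rw [sum_smul_crossPolytopeClass, Submodule.Quotient.mk_eq_zero] at hg
  have h0 := eq_zero_of_mem_boundaries hg (snakeCombination_mem_supportedOn hI g)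
  have h1 : snakeCombination hI g = 0 := Subtype.ext h0
  have h2 : g = 0 := leadingCoefficients_comp_injective hI (by
    rw [LinearMap.comp_apply, h1, map_zero, map_zero])
  exact fun x => congrFun h2 x

theorem top_le_span_crossPolytopeClass (hI : I ⊆ Finset.Icc 1 n) :
    ⊤ ≤ Submodule.span ℚ (Set.range fun x : {x : SignedPerm I // x.IsBSnake} =>
      x.1.crossPolytopeClass hI) := by
  rintro c -
  obtain ⟨z, rfl⟩ := Submodule.Quotient.mk_surjective _ c
  have hbz : boundary _ z.1 = 0 := z.2.2
  obtain ⟨w, hd, hzw, hw⟩ := exists_sub_mem_boundaries z.1 z.2.1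
    (by rw [hbz]; exact Submodule.zero_mem _)
  have hbw : boundary _ w = 0 := by
    obtain ⟨c, -, hc⟩ := Submodule.mem_map.1 hzw
    have h1 := boundary_boundary_coxeter c
    rwa [hc, map_sub, hbz, zero_sub, neg_eq_zero] at h1
  obtain ⟨g, hg⟩ := exists_snakeCombination_eq hI ⟨w, hd, hbw⟩ hw
  have h : (Submodule.Quotient.mk z :
      ReducedHomology (coxeterSubcomplex n I) (((I.card : ℤ) - 1) / 2)) =
      ∑ x, g x • x.1.crossPolytopeClass hI := by
    rw [sum_smul_crossPolytopeClass, hg]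
    exact (Submodule.Quotient.eq _).2 hzw
  rw [h]
  exact Submodule.sum_mem _ fun x _ => Submodule.smul_mem _ _ (Submodule.subset_span ⟨x, rfl⟩)

end Basis

end TypeB

end

theorem mainTheorem3 (n : ℕ) (I : Finset ℕ) (hI : I ⊆ Finset.Icc 1 n) :
    ∃ b : Module.Basis {x : TypeB.SignedPerm I // x.IsBSnake} ℚ
        (TypeB.ReducedHomology (TypeB.coxeterSubcomplex n I) (((I.card : ℤ) - 1) / 2)),
      ∀ x, b x = x.1.crossPolytopeClass hI := by
  have := Fintype.ofFinite {x : TypeB.SignedPerm I // x.IsBSnake}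
  exact ⟨Module.Basis.mk (TypeB.linearIndependent_crossPolytopeClass hI)
    (TypeB.top_le_span_crossPolytopeClass hI), fun x => Module.Basis.mk_apply _ _ x⟩
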